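/- Let $K$ be a field of characteristic zero, let $R = K[X_1,\ldots,X_n]$ with partial derivatives $\partial_i = \partial/\partial X_i$, and let $L \supseteq K$ be an algebraically closed field. Let $I \subset R$ be a zero-dimensional ideal, that is, an ideal such that the length of $R/I$ is finite and non-zero, and let $$V(I)_L = \{\mathbf a \in L^n \mid f(\mathbf a) = 0 \text{ for all } f \in I\}.$$ Let $H^n_I(R)$ be the $n$-th local cohomology module of $R$ with respect to $I$; for any generators $f_1,\ldots,f_s$ of $I$ it is the $n$-th cohomology of the Čech complex $$0 \to R \to \bigoplus_i R_{f_i} \to \bigoplus_{i<j} R_{f_if_j} \to \cdots \to R_{f_1\cdots f_s} \to 0,$$ and $\partial_1,\ldots,\partial_n$ act on it through their extensions (by the quotient rule) to the localizations of $R$. For a $K$-vector space $N$ with commuting operators $\partial_1,\ldots,\partial_n$ let $H^i(\partial; N)$ denote the $i$-th cohomology of the de Rham complex of $N$, whose term in degree $p$ is $\bigoplus_{j_1<\cdots<j_p} N\, dX_{j_1}\wedge\cdots\wedge dX_{j_p}$ and whose differential is $\omega \mapsto \sum_i dX_i \wedge \partial_i\omega$. Then $H^i(\partial; H^n_I(R))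 = 0$ for all $i < n$, the set $V(I)_L$ and the dimension of $H^n(\partial; H^n_I(R))$ are finite, and $$\dim_K H^n(\partial; H^n_I(R)) = \sharp V(I)_L .$$ -/

import Mathlib

universe u v

noncomputable section

namespace DeRhamLC

/-! ### Cohomology of a sequence of linear maps -/

section Cohomology

variable {K : Type u} [Field K] {C : ℕ → Type u} [∀ p, AddCommGroup (C p)] [∀ p, Module K (C p)]

/-- The coboundaries in degree `p`: zero in degree `0`, and the image of `d (p - 1)` for `p ≥ 1`. -/
def coboundaries (d : ∀ p, C p →ₗ[K] C (p + 1)) : ∀ p, Submodule K (C p)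
  | 0 => ⊥
  | p + 1 => LinearMap.range (d p)

/-- The `p`-th cohomology `ker d^p / im d^{p-1}` of the cochain complex
`0 → C 0 → C 1 → C 2 → ⋯`. -/
abbrev Cohomology (d : ∀ p, C p →ₗ[K] C (p + 1)) (p : ℕ) : Type u :=
  LinearMap.ker (d p) ⧸ (coboundaries d p).submoduleOf (LinearMap.ker (d p))

/-- The endomorphism of cohomology induced by an endomorphism of a cochain complex. -/
def Cohomology.map (d : ∀ p, C p →ₗ[K] C (p + 1)) (θ : ∀ p, C p →ₗ[K] C p)
    (h : ∀ p c, d p (θ p c) = θ (p + 1) (d p c)) (p : ℕ) :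
    Cohomology d p →ₗ[K] Cohomology d p :=
  Submodule.mapQ _ _
    ((θ p).restrict (p := LinearMap.ker (d p)) (q := LinearMap.ker (d p)) (by
      intro c hc
      rw [LinearMap.mem_ker] at hc ⊢
      rw [h, hc, map_zero]))
    (by
      rintro ⟨c, hc⟩ hcb
      cases p with
      | zero =>
        have hc0 : c = 0 := hcb
        change θ 0 c = 0
        rw [hc0, map_zero]
      | succ p =>
        obtain ⟨b, hb⟩ : ∃ b, d p b = c := hcb
        exact ⟨θ p b, by rw [h, hb]; rfl⟩)

end Cohomology

/-! ### Alternating cochains indexed by subsets -/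

/-- The subsets of `{0, …, s - 1}` with exactly `p` elements. -/
abbrev Subsets (s p : ℕ) : Type := {S : Finset (Fin s) // S.card = p}

/-- The `p`-element set `T \ {i}`, for a `(p + 1)`-element set `T` and `i ∈ T`. -/
abbrev Subsets.erase {s p : ℕ} (T : Subsets s (p + 1)) (i : {i // i ∈ T.1}) : Subsets s p :=
  ⟨T.1.erase i.1, by rw [Finset.card_erase_of_mem i.2, T.2, Nat.add_sub_cancel]⟩

/-- The sign `(-1) ^ #{j ∈ T | j < i}`. -/
def sgn (K : Type u) [Field K] {s : ℕ} (T : Finset (Fin s)) (i : Fin s) : K :=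
  (-1) ^ (T.filter (· < i)).card

/-- Given modules `A S` for `S ⊆ {0, …, s - 1}` and maps `φ T i : A (T \ {i}) → A T` for `i ∈ T`,
the map `∏_{|S| = p} A S → ∏_{|T| = p + 1} A T` with
`(d c)_T = ∑_{i ∈ T} (-1) ^ #{j ∈ T | j < i} φ T i (c_{T \ {i}})`. -/
def altDiff {K : Type u} [Field K] {s : ℕ} (A : Finset (Fin s) → Type u)
    [∀ S, AddCommGroup (A S)] [∀ S, Module K (A S)]
    (φ : ∀ (T : Finset (Fin s)) (i : {i // i ∈ T}), A (T.erase i.1) →ₗ[K] A T) (p : ℕ) :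
    (∀ S : Subsets s p, A S.1) →ₗ[K] (∀ T : Subsets s (p + 1), A T.1) where
  toFun c T := ∑ i : {i // i ∈ T.1}, sgn K T.1 i.1 • φ T.1 i (c (T.erase i))
  map_add' c c' := by
    funext T
    simp [Finset.sum_add_distrib]
  map_smul' r c := by
    funext T
    simp [Finset.smul_sum, smul_comm r]

/-! ### The de Rham complex -/

/-- The differential of the de Rham complex `K(∂; N)` of a `K`-vector space `N` with operators
`∂_1, …, ∂_n`: a `p`-cochain `ω = (ω_S)_{|S| = p}` stands for `∑_S ω_S dx_S`, and
`(d ω)_T = ∑_{i ∈ T} (-1) ^ #{j ∈ T | j < i} ∂_i ω_{T \ {i}}`. -/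
def deRhamDiff {K : Type u} [Field K] {N : Type u} [AddCommGroup N] [Module K N] {n : ℕ}
    (del : Fin n → N →ₗ[K] N) (p : ℕ) :
    (Subsets n p → N) →ₗ[K] (Subsets n (p + 1) → N) :=
  altDiff (fun _ => N) (fun _ i => del i.1) p

/-- The de Rham cohomology `H^p(∂; N)`. -/
abbrev DeRhamCohomology {K : Type u} [Field K] {N : Type u} [AddCommGroup N] [Module K N] {n : ℕ}
    (del : Fin n → N →ₗ[K] N) (p : ℕ) : Type u :=
  Cohomology (C := fun p => Subsets n p → N) (deRhamDiff del) p

/-! ### Extension of a derivation to a localization -/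

section Localization

variable {K R : Type u} [Field K] [CommRing R] [Algebra K R]

/-- The algebra map `R → R_g[ε]`, `a ↦ a + D(a) ε`, extended to `R_g`. -/
def awayDual (D : Derivation K R R) (g : R) :
    Localization.Away g →ₐ[K]
      TrivSqZeroExt (Localization.Away g) (Localization.Away g) :=
  IsLocalization.liftAlgHom (M := Submonoid.powers g)
    (f := ({ toFun := fun a =>
               (TrivSqZeroExt.inl (algebraMap R (Localization.Away g) a) +
                 TrivSqZeroExt.inr (algebraMap R (Localization.Away g) (D a)))
             map_one' := by ext <;> simp
             map_zero' := by ext <;> simp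
             map_add' := fun a b => by ext <;> simp [Algebra.smul_def]
             map_mul' := fun a b => by
               ext
               · simp
               · simp only [Derivation.leibniz, smul_eq_mul, map_mul, map_add,
                   TrivSqZeroExt.snd_mul, TrivSqZeroExt.snd_add, TrivSqZeroExt.fst_add,
                   TrivSqZeroExt.snd_inl, TrivSqZeroExt.snd_inr, TrivSqZeroExt.fst_inl,
                   TrivSqZeroExt.fst_inr, zero_add, add_zero, op_smul_eq_smul]
             commutes' := fun r => by
               rw [TrivSqZeroExt.algebraMap_eq_inl', Derivation.map_algebraMap, map_zero,
                 ← IsScalarTower.algebraMap_apply, TrivSqZeroExt.inr_zero, add_zero] } :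
        R →ₐ[K] TrivSqZeroExt (Localization.Away g) (Localization.Away g)))
    (by
      intro y
      rw [TrivSqZeroExt.isUnit_iff_isUnit_fst]
      simpa using IsLocalization.map_units (Localization.Away g) y)

theorem awayDual_algebraMap (D : Derivation K R R) (g a : R) :
    awayDual D g (algebraMap R (Localization.Away g) a) =
      TrivSqZeroExt.inl (algebraMap R (Localization.Away g) a) +
        TrivSqZeroExt.inr (algebraMap R (Localization.Away g) (D a)) := by
  simp [awayDual]

theorem fst_awayDual (D : Derivation K R R) (g : R) (x : Localization.Away g) :
    (awayDual D g x).fst = x := by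
  have h : ((TrivSqZeroExt.fstHom K (Localization.Away g) (Localization.Away g)).comp
      (awayDual D g) : Localization.Away g →+* Localization.Away g) = RingHom.id _ := by
    apply IsLocalization.ringHom_ext (Submonoid.powers g)
    ext a
    simp [awayDual_algebraMap]
  exact congrArg (fun ψ : Localization.Away g →+* Localization.Away g => ψ x) h

/-- The extension of a `K`-derivation `D` of `R` to `R_g = R[1/g]` (the quotient rule). -/
def awayDerivation (D : Derivation K R R) (g : R) :
    Derivation K (Localization.Away g) (Localization.Away g) :=
  Derivation.mk'
    ((TrivSqZeroExt.sndHom _ _).restrictScalars K ∘ₗ (awayDual D g).toLinearMap) (by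
      intro x y
      simp [fst_awayDual, mul_comm])

theorem awayDerivation_algebraMap (D : Derivation K R R) (g a : R) :
    awayDerivation D g (algebraMap R (Localization.Away g) a) =
      algebraMap R (Localization.Away g) (D a) := by
  change (awayDual D g (algebraMap R (Localization.Away g) a)).snd = _
  rw [awayDual_algebraMap, TrivSqZeroExt.snd_add, TrivSqZeroExt.snd_inl, TrivSqZeroExt.snd_inr,
    zero_add]

/-- The canonical map `R_g → R_h`, for `g` dividing `h`. -/
def awayMap {g h : R} (hgh : g ∣ h) : Localization.Away g →ₐ[K] Localization.Away h :=
  IsLocalization.liftAlgHom (M := Submonoid.powers g)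
    (f := IsScalarTower.toAlgHom K R (Localization.Away h)) (by
      rintro ⟨_, k, rfl⟩
      have hu : IsUnit (algebraMap R (Localization.Away h) h) :=
        IsLocalization.Away.algebraMap_isUnit h
      simpa using (isUnit_of_dvd_unit (map_dvd _ hgh) hu).pow k)

theorem awayMap_algebraMap {g h : R} (hgh : g ∣ h) (a : R) :
    awayMap (K := K) hgh (algebraMap R (Localization.Away g) a) =
      algebraMap R (Localization.Away h) a := by
  simp [awayMap]

/-- The canonical maps between localizations commute with the extended derivations. -/
theorem awayMap_awayDerivation (D : Derivation K R R) {g h : R} (hgh : g ∣ h)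
    (x : Localization.Away g) :
    awayMap (K := K) hgh (awayDerivation D g x) = awayDerivation D h (awayMap (K := K) hgh x) := by
  obtain ⟨⟨a, m⟩, hx⟩ := IsLocalization.surj (Submonoid.powers g) x
  simp only at hx
  have hu : IsUnit (algebraMap R (Localization.Away h) (m : R)) := by
    have := (IsLocalization.map_units (Localization.Away g) m).map (awayMap (K := K) hgh)
    rwa [awayMap_algebraMap] at this
  have h1 := congrArg (fun y => awayMap (K := K) hgh (awayDerivation D g y)) hx
  have h2 := congrArg (fun y => awayDerivation D h (awayMap (K := K) hgh y)) hx
  simp only [Derivation.leibniz, map_add, map_mul, smul_eq_mul, awayDerivation_algebraMap,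
    awayMap_algebraMap] at h1 h2
  apply hu.mul_left_cancel
  linear_combination h1 - h2

end Localization

/-! ### Local cohomology as Čech cohomology -/

section Cech

variable {K R : Type u} [Field K] [CommRing R] [Algebra K R] {s : ℕ}

/-- The localization `R_{f_S}`, where `f_S = ∏_{i ∈ S} f_i`. -/
abbrev CechPiece (f : Fin s → R) (S : Finset (Fin s)) : Type u :=
  Localization.Away (∏ i ∈ S, f i)

theorem prod_erase_dvd (f : Fin s → R) (T : Finset (Fin s)) (i : Fin s) :
    ∏ j ∈ T.erase i, f j ∣ ∏ j ∈ T, f j :=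
  Finset.prod_dvd_prod_of_subset _ _ _ (Finset.erase_subset _ _)

/-- The differential of the Čech complex
`0 → R → ∏_i R_{f_i} → ∏_{i < j} R_{f_i f_j} → ⋯ → R_{f_1 ⋯ f_s} → 0`. -/
def cechDiff (K : Type u) [Field K] [Algebra K R] (f : Fin s → R) (p : ℕ) :
    (∀ S : Subsets s p, CechPiece f S.1) →ₗ[K] (∀ T : Subsets s (p + 1), CechPiece f T.1) :=
  altDiff (CechPiece f) (fun T i => (awayMap (K := K) (prod_erase_dvd f T i.1)).toLinearMap) p

/-- The local cohomology `H^p_I(R)` (as a `K`-vector space) of the ideal `I = (f_1, …, f_s)` of the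
Noetherian ring `R`, computed by the Čech complex on the generators `f_1, …, f_s`. -/
abbrev LocalCohomology (K : Type u) [Field K] [Algebra K R] (f : Fin s → R) (p : ℕ) : Type u :=
  Cohomology (C := fun p => ∀ S : Subsets s p, CechPiece f S.1) (cechDiff K f) p

/-- The componentwise action of a derivation of `R` on the Čech complex. -/
def cechDerivation (D : Derivation K R R) (f : Fin s → R) (p : ℕ) :
    (∀ S : Subsets s p, CechPiece f S.1) →ₗ[K] (∀ S : Subsets s p, CechPiece f S.1) :=
  LinearMap.pi fun S => (awayDerivation D (∏ i ∈ S.1, f i)).toLinearMap ∘ₗ LinearMap.proj S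

theorem cechDiff_cechDerivation (D : Derivation K R R) (f : Fin s → R) (p : ℕ)
    (c : ∀ S : Subsets s p, CechPiece f S.1) :
    cechDiff K f p (cechDerivation D f p c) = cechDerivation D f (p + 1) (cechDiff K f p c) := by
  funext T
  change (∑ i : {i // i ∈ T.1}, _ • _) = awayDerivation D _ (∑ i : {i // i ∈ T.1}, _ • _)
  rw [map_sum]
  refine Finset.sum_congr rfl fun i _ => ?_
  rw [Derivation.map_smul]
  refine congrArg _ ?_
  exact awayMap_awayDerivation D (prod_erase_dvd f T.1 i.1) (c (T.erase i))

/-- The action of a derivation of `R` on local cohomology. -/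
def lcDerivation (D : Derivation K R R) (f : Fin s → R) (p : ℕ) :
    LocalCohomology K f p →ₗ[K] LocalCohomology K f p :=
  Cohomology.map _ (cechDerivation D f) (cechDiff_cechDerivation D f) p

end Cech

/-- The action of `∂_i = ∂/∂X_i` on the local cohomology of `R = K[X_1, …, X_n]` with respect to the
ideal generated by `f_1, …, f_s`. -/
def lcPartial {K : Type u} [Field K] {n s : ℕ} (f : Fin s → MvPolynomial (Fin n) K) (p : ℕ)
    (i : Fin n) : LocalCohomology K f p →ₗ[K] LocalCohomology K f p :=
  lcDerivation (MvPolynomial.pderiv i) f p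

/-- An ideal `I` is zero-dimensional if the length of `R / I` is finite and non-zero. -/
def IsZeroDimensional {R : Type u} [CommRing R] (I : Ideal R) : Prop :=
  Module.length R (R ⧸ I) ≠ ⊤ ∧ Module.length R (R ⧸ I) ≠ 0

end DeRhamLC

end

noncomputable section

namespace DeRhamLC

/-! ### Alternating sums over subsets -/

section AltSum

variable {N : Type*} [AddCommGroup N] {n : ℕ}

/-! Write `N` for the local cohomology module in degree `n`. It is a module over the Weyl algebra,
and every element is killed by a power of each element of the radical of `I`. As `R / I.radical` is
finite and reduced and `K` has characteristic zero, the minimal polynomial `g_i` of the class of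
`X_i` is separable, and `G_i = g_i(X_i)` lies in the radical (`exists_separable_aeval_mem_radical`).
So each `G_i` acts locally nilpotently on `N`.

This torsion alone determines the de Rham cohomology. In one variable, `[d, g^k] = k g^(k-1) g'` and
a Bézout relation `a g + b g' = 1` show that `d` is injective and that `N = ker g(x) ⊕ d N`
(`weyl_pow_descent`, `weyl_span`). Treating the variables one at a time gives `N = ⋂ ker G_i ⊕ ∑ ∂_i
N` (`weyl_decomposition`) and makes the `∂_i` a regular sequence (`weyl_regular`). The de Rham
complex is a Koszul complex on the `∂_i`, hence exact below degree `n`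
(`exists_altSum_eq_of_regular`), and its top cohomology `N / ∑ ∂_i N` is the common kernel of the
`G_i`.

That kernel is computed by commutative algebra. The `G_i` involve distinct variables, so they form a
regular sequence, generating an ideal `J` inside the radical of `I`. Dividing by them one at a time,
the connecting maps of Čech cohomology identify the common kernel with the sections of `R / J`
supported on `V(I)` (`modCech_of_regular`). Separability makes `R / J` unramified over `K`, hence
finite and reduced, so a product of fields; these sections then form a complement of the image of
`I`, isomorphic to `R / (J + I)` (`torsionSections_equiv`). That ring is again finite and reduced,
so its dimension is its number of `L`-points, and `V(J + I) = V(I)` because `J` lies in the radical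
of `I`. -/

/-- The Koszul differential on all cochains `ω : Finset (Fin n) → N` at once. -/
def altSum (D : Fin n → N →+ N) (ω : Finset (Fin n) → N) (T : Finset (Fin n)) : N :=
  ∑ i ∈ T, ((-1 : ℤ) ^ (T.filter (· < i)).card) • D i (ω (T.erase i))

variable (D : Fin n → N →+ N)

theorem altSum_congr {ω η : Finset (Fin n) → N} {T : Finset (Fin n)}
    (h : ∀ i ∈ T, ω (T.erase i) = η (T.erase i)) : altSum D ω T = altSum D η T :=
  Finset.sum_congr rfl fun i hi => by rw [h i hi]

theorem altSum_add (ω η : Finset (Fin n) → N) (T : Finset (Fin n)) :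
    altSum D (fun S => ω S + η S) T = altSum D ω T + altSum D η T := by
  simp [altSum, Finset.sum_add_distrib]

theorem altSum_sub (ω η : Finset (Fin n) → N) (T : Finset (Fin n)) :
    altSum D (fun S => ω S - η S) T = altSum D ω T - altSum D η T := by
  simp [altSum, smul_sub, Finset.sum_sub_distrib]

theorem altSum_zsmul (z : ℤ) (ω : Finset (Fin n) → N) (T : Finset (Fin n)) :
    altSum D (fun S => z • ω S) T = z • altSum D ω T := by
  simp [altSum, Finset.smul_sum, smul_comm z]

theorem altSum_map (φ : N →+ N) (h : ∀ i x, D i (φ x) = φ (D i x))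
    (ω : Finset (Fin n) → N) (T : Finset (Fin n)) :
    altSum D (fun S => φ (ω S)) T = φ (altSum D ω T) := by
  simp [altSum, h]

/-- Expansion of the differential along the largest index. -/
theorem altSum_insert_max {S : Finset (Fin n)} {i : Fin n} (hi : ∀ j ∈ S, j < i)
    (ω : Finset (Fin n) → N) :
    altSum D ω (insert i S) =
      altSum D (fun S' => ω (insert i S')) S + ((-1 : ℤ) ^ S.card) • D i (ω S) := by
  have hiS : i ∉ S := fun h => lt_irrefl _ (hi i h)
  rw [altSum, Finset.sum_insert hiS, add_comm]
  congr 1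
  · refine Finset.sum_congr rfl fun j hj => ?_
    have hji : j ≠ i := (hi j hj).ne
    rw [Finset.erase_insert_of_ne hji.symm, Finset.filter_insert, if_neg (hi j hj).le.not_gt]
  · rw [Finset.erase_insert hiS, Finset.filter_insert, if_neg (lt_irrefl i),
      Finset.filter_true_of_mem hi]

/-- Induction on the largest index `i` of the set. The two terms containing a single `D i` come with
opposite signs, since removing an element `j` from `S` changes the parity of its cardinality, and
they cancel because the operators commute. -/
theorem altSum_altSum (hD : ∀ i j x, D i (D j x) = D j (D i x)) (ω : Finset (Fin n) → N)
    (T : Finset (Fin n)) : altSum D (altSum D ω) T = 0 := by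
  induction T using Finset.induction_on_max generalizing ω with
  | empty => simp [altSum]
  | insert i S hi ih =>
    rw [altSum_insert_max D hi]
    have h1 : altSum D (fun S' => altSum D ω (insert i S')) S =
        altSum D (fun S' => altSum D (fun S'' => ω (insert i S'')) S' +
          (-((-1 : ℤ) ^ S.card)) • D i (ω S')) S := by
      refine altSum_congr D fun j hj => ?_
      rw [altSum_insert_max D (fun k hk => hi k (Finset.mem_of_mem_erase hk)),
        Finset.card_erase_of_mem hj]
      congr 2
      have : S.card = (S.card - 1) + 1 := by
        have := Finset.card_pos.2 ⟨j, hj⟩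
        omega
      conv_rhs => rw [this, pow_succ]
      simp
    rw [h1, altSum_add, ih, altSum_zsmul, altSum_map D (D i) (fun j x => hD j i x)]
    simp

end AltSum

/-! ### Koszul complexes of regular sequences of operators -/

section Koszul

variable {N : Type*} [AddCommGroup N] {n : ℕ} (D : Fin n → N →+ N)

/-- The subgroup `∑_{i ∈ U} D_i N`. -/
def rangeSum (U : Finset (Fin n)) : AddSubgroup N := ⨆ i ∈ U, (D i).range

theorem altSum_mem_rangeSum (ω : Finset (Fin n) → N) (T : Finset (Fin n)) :
    altSum D ω T ∈ rangeSum D T :=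
  sum_mem fun i hi => zsmul_mem
    ((le_iSup₂_of_le (f := fun i (_ : i ∈ T) => (D i).range) i hi le_rfl) ⟨_, rfl⟩) _

/-- A cochain supported on the single set `T.erase i` has only the term `± D i y` in its
differential at `T`; the sign is its own inverse and can be absorbed into the cochain. -/
theorem exists_altSum_eq {T : Finset (Fin n)} {x : N} (hx : x ∈ rangeSum D T) :
    ∃ ω : Finset (Fin n) → N, altSum D ω T = x := by
  have key : rangeSum D T ≤ AddMonoidHom.range
      ({ toFun := fun ω => altSum D ω T
         map_zero' := by simp [altSum]
         map_add' := fun ω η => altSum_add D ω η T } : (Finset (Fin n) → N) →+ N) := by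
    refine iSup₂_le fun i hi => ?_
    rintro _ ⟨y, rfl⟩
    refine ⟨fun S => if S = T.erase i then ((-1 : ℤ) ^ (T.filter (· < i)).card) • y else 0, ?_⟩
    simp only [AddMonoidHom.coe_mk, ZeroHom.coe_mk]
    rw [altSum, Finset.sum_eq_single i]
    · simp [smul_smul, ← mul_pow]
    · intro j hj hji
      have : T.erase j ≠ T.erase i := fun h => by
        have : i ∈ T.erase j := Finset.mem_erase.2 ⟨hji.symm, hi⟩
        rw [h] at this
        simp at this
      simp [this]
    · exact fun h => (h hi).elim
  exact key hx

/-- If each `D_i` is injective on `N / ∑_{j < i} D_j N`, then the Koszul complex of the `D_i` is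
exact in degrees below the number of operators. -/
theorem exists_altSum_eq_of_regular (hD : ∀ i j x, D i (D j x) = D j (D i x))
    (U : Finset (Fin n))
    (hreg : ∀ i ∈ U, ∀ x, D i x ∈ rangeSum D (U.filter (· < i)) →
      x ∈ rangeSum D (U.filter (· < i)))
    (p : ℕ) (hp : p < U.card) (ω : Finset (Fin n) → N)
    (hω : ∀ T ⊆ U, T.card = p + 1 → altSum D ω T = 0) :
    ∃ γ : Finset (Fin n) → N, ∀ S ⊆ U, S.card = p → altSum D γ S = ω S := by
  induction U using Finset.induction_on_max generalizing p ω with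
  | empty => simp at hp
  | insert i U hi ih =>
    have hiU : i ∉ U := fun h => lt_irrefl _ (hi i h)
    have hfi : (insert i U).filter (· < i) = U := by
      rw [Finset.filter_insert, if_neg (lt_irrefl i), Finset.filter_true_of_mem hi]
    have hreg' : ∀ j ∈ U, ∀ x, D j x ∈ rangeSum D (U.filter (· < j)) →
        x ∈ rangeSum D (U.filter (· < j)) := by
      intro j hj x hx
      have := hreg j (Finset.mem_insert_of_mem hj) x
      rw [Finset.filter_insert, if_neg (hi j hj).le.not_gt] at this
      exact this hx
    rw [Finset.card_insert_of_notMem hiU] at hp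
    -- the part of `ω` without the largest index
    obtain ⟨γ, hγ⟩ : ∃ γ : Finset (Fin n) → N, ∀ S ⊆ U, S.card = p → altSum D γ S = ω S := by
      rcases Nat.lt_or_ge p U.card with h | h
      · exact ih hreg' p h ω fun T hT hTc => hω T (hT.trans (Finset.subset_insert _ _)) hTc
      -- Here `U` is its only `p`-element subset, and the induction hypothesis does not apply. The
      -- cocycle condition at `insert i U` puts `D i (ω U)` in `∑ D_j N`, and regularity of `D i`
      -- finishes.
      · have hpU : p = U.card := by omega
        have h1 := hω (insert i U) subset_rfl (by rw [Finset.card_insert_of_notMem hiU, hpU])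
        rw [altSum_insert_max D hi] at h1
        have h2 : D i (ω U) ∈ rangeSum D U := by
          have h3 := altSum_mem_rangeSum D (fun S' => ω (insert i S')) U
          have h4 : D i (ω U) = -((-1 : ℤ) ^ U.card) •
              altSum D (fun S' => ω (insert i S')) U := by
            rw [eq_neg_of_add_eq_zero_left h1]
            simp [smul_smul, ← mul_pow]
          rw [h4]
          exact zsmul_mem h3 _
        have h5 := hreg i (Finset.mem_insert_self _ _) (ω U)
        rw [hfi] at h5
        obtain ⟨γ, hγ⟩ := exists_altSum_eq D (h5 h2)
        refine ⟨γ, fun S hS hSc => ?_⟩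
        rw [Finset.eq_of_subset_of_card_le hS (by omega), hγ]
    -- the coefficient of the largest index, after subtracting the coboundary of `γ`
    have hnot : ∀ S : Finset (Fin n), S ⊆ U → ∀ i' ∈ S, i' < i := fun S hS j hj => hi j (hS hj)
    let γ₁ : Finset (Fin n) → N := fun S => if i ∈ S then 0 else γ S
    have hγ₁ : ∀ S ⊆ U, S.card = p → altSum D γ₁ S = ω S := by
      intro S hS hSc
      rw [← hγ S hS hSc]
      refine altSum_congr D fun j hj => if_neg fun h => hiU (hS (Finset.mem_of_mem_erase h))
    let η : Finset (Fin n) → N := fun S => ω S - altSum D γ₁ S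
    have hη : ∀ T ⊆ insert i U, T.card = p + 1 → altSum D η T = 0 := by
      intro T hT hTc
      rw [altSum_sub, altSum_altSum D hD, hω T hT hTc, sub_zero]
    have hη0 : ∀ S ⊆ U, S.card = p → η S = 0 := fun S hS hSc => by
      simp only [η]
      rw [hγ₁ S hS hSc, sub_self]
    rcases Nat.eq_zero_or_pos p with rfl | hp0
    · refine ⟨γ₁, fun S hS hSc => ?_⟩
      rw [Finset.card_eq_zero] at hSc
      subst hSc
      exact hγ₁ ∅ (Finset.empty_subset _) rfl
    -- `η` vanishes on the `p`-subsets of `U`, so its coefficients along `i` form a cocycle of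
    -- degree `p - 1` on `U`. Degree zero was split off to make `p - 1` meaningful.
    obtain ⟨β, hβ⟩ := ih hreg' (p - 1) (by omega) (fun S => η (insert i S)) (by
      intro T hT hTc
      have hTp : T.card = p := by omega
      have h1 := hη (insert i T) (Finset.insert_subset_insert _ hT) (by
        rw [Finset.card_insert_of_notMem (fun h => hiU (hT h)), hTp])
      rw [altSum_insert_max D (hnot T hT), hη0 T hT hTp] at h1
      simpa using h1)
    refine ⟨fun S => γ₁ S + if i ∈ S then β (S.erase i) else 0, fun S hS hSc => ?_⟩
    rw [altSum_add]
    by_cases hiS : i ∈ S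
    · obtain ⟨S', hS', rfl⟩ : ∃ S', i ∉ S' ∧ insert i S' = S :=
        ⟨S.erase i, Finset.notMem_erase _ _, Finset.insert_erase hiS⟩
      have hS'U : S' ⊆ U := (Finset.insert_subset_insert_iff hS').1 hS
      rw [Finset.card_insert_of_notMem hS'] at hSc
      have h1 := hβ S' hS'U (by omega)
      rw [altSum_insert_max D (hnot S' hS'U) (fun S => if i ∈ S then β (S.erase i) else 0)]
      have h2 : altSum D (fun S'' => if i ∈ insert i S'' then β ((insert i S'').erase i) else 0) S'
          = altSum D β S' := by
        refine altSum_congr D fun j hj => ?_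
        rw [if_pos (Finset.mem_insert_self _ _),
          Finset.erase_insert fun h => hS' (Finset.mem_of_mem_erase h)]
      rw [h2, h1, if_neg hS']
      simp [η]
    · have hSU : S ⊆ U := (Finset.subset_insert_iff_of_notMem hiS).1 hS
      rw [hγ₁ S hSU hSc]
      have : altSum D (fun S => if i ∈ S then β (S.erase i) else 0) S = altSum D (fun _ => 0) S :=
        altSum_congr D fun j hj => if_neg fun h => hiS (Finset.mem_of_mem_erase h)
      rw [this]
      simp [altSum]

end Koszul

/-! ### Modules over the Weyl algebra with finite support -/

section Weyl

open Polynomial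

variable {K : Type*} [Field K] {N : Type*} [AddCommGroup N] [Module K N]

/-- The commutation rule `[d, p(x)] = p'(x)` in the Weyl algebra. -/
theorem weyl_commutator {x d : Module.End K N} (h : d * x - x * d = 1) (p : K[X]) :
    d * aeval x p = aeval x p * d + aeval x (derivative p) := by
  have hdx : d * x = x * d + 1 := by rw [← h]; abel
  induction p using Polynomial.induction_on' with
  | add p q hp hq =>
    simp only [map_add, mul_add, add_mul, hp, hq]
    abel
  | monomial k a =>
    have hk : ∀ k : ℕ, d * x ^ k = x ^ k * d + (k : Module.End K N) * x ^ (k - 1) := by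
      intro k
      induction k with
      | zero => simp
      | succ k ih =>
        rcases Nat.eq_zero_or_pos k with rfl | hk
        · simp [hdx]
        · rw [pow_succ, ← mul_assoc, ih, add_mul, mul_assoc, hdx, mul_assoc (k : Module.End K N),
            ← pow_succ, Nat.sub_add_cancel hk, Nat.add_sub_cancel]
          push_cast
          noncomm_ring
    have hc := (Algebra.commutes a d)
    rw [derivative_monomial, aeval_monomial, aeval_monomial, ← mul_assoc, ← hc, mul_assoc, hk,
      mul_add, ← mul_assoc, map_mul, map_natCast, mul_assoc, mul_assoc]

variable [CharZero K] {x d : Module.End K N} (h : d * x - x * d = 1) {g : K[X]}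
  (hg : g.Separable)

include h hg

/-- Applying `[d, g^(k+1)] = (k+1) g^k g'` to `v` gives `g^k g' v = 0`, as `k + 1` is invertible.
Since `g` and `g'` generate the unit ideal, `g^k v = 0` follows. -/
theorem weyl_pow_descent {k : ℕ} {v : N} (hv : aeval x (g ^ (k + 1)) v = 0)
    (hdv : aeval x (g ^ (k + 1)) (d v) = 0) : aeval x (g ^ k) v = 0 := by
  obtain ⟨a, b, hab⟩ := hg
  have h1 := congrArg (fun φ : Module.End K N => φ v) (weyl_commutator h (g ^ (k + 1)))
  simp only [Module.End.mul_apply, LinearMap.add_apply, hv, hdv, map_zero, zero_add,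
    derivative_pow, Nat.add_sub_cancel] at h1
  have h2 : aeval x (g ^ k * derivative g) v = 0 := by
    have h3 : ((k + 1 : ℕ) : K) • aeval x (g ^ k * derivative g) v = 0 := by
      rw [h1, ← LinearMap.smul_apply, ← map_smul]
      congr 2
      rw [smul_eq_C_mul, mul_assoc]
    exact (smul_eq_zero.1 h3).resolve_left (by exact_mod_cast Nat.succ_ne_zero k)
  have h4 : g ^ k = a * g ^ (k + 1) + b * (g ^ k * derivative g) := by
    linear_combination (-g ^ k) * hab
  rw [h4, map_add, map_mul, map_mul, LinearMap.add_apply, Module.End.mul_apply,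
    Module.End.mul_apply, hv, h2]
  simp

theorem weyl_injective (htors : ∀ v : N, ∃ k, aeval x (g ^ k) v = 0) {v : N} (hv : d v = 0) :
    v = 0 := by
  obtain ⟨k, hk⟩ := htors v
  induction k with
  | zero => simpa using hk
  | succ k ih => exact ih (weyl_pow_descent h hg hk (by rw [hv, map_zero]))

/-- This says at once that `d` is injective and that `d N` meets `ker g(x)` only in zero: the
hypothesis feeds the descent at every exponent. -/
theorem weyl_disjoint (htors : ∀ v : N, ∃ k, aeval x (g ^ k) v = 0) {v : N}
    (hv : aeval x g (d v) = 0) : v = 0 := by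
  obtain ⟨k, hk⟩ := htors v
  induction k with
  | zero => simpa using hk
  | succ k ih =>
    refine ih (weyl_pow_descent h hg hk ?_)
    rw [pow_succ, map_mul, Module.End.mul_apply, hv, map_zero]

/-- Modulo `d W` the torsion exponent of `u` can be lowered step by step until it is `1`. The
invariant subspace `W` is what allows the argument to be repeated inside the common kernel of
operators in other variables. -/
theorem weyl_span {W : Submodule K N} (hWx : ∀ w ∈ W, x w ∈ W) (hWd : ∀ w ∈ W, d w ∈ W)
    (htors : ∀ v : N, ∃ k, aeval x (g ^ k) v = 0) {u : N} (hu : u ∈ W) :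
    ∃ w ∈ W, ∃ v ∈ W, aeval x g w = 0 ∧ u = w + d v := by
  obtain ⟨a, b, hab⟩ := id hg
  have hWp : ∀ p : K[X], ∀ w ∈ W, aeval x p w ∈ W := fun p w hw => by
    have hpow : ∀ k : ℕ, (x ^ k) w ∈ W := fun k => by
      induction k with
      | zero => simpa using hw
      | succ k ih => rw [pow_succ', Module.End.mul_apply]; exact hWx _ ih
    rw [aeval_eq_sum_range, LinearMap.sum_apply]
    exact W.sum_mem fun k _ => W.smul_mem _ (hpow k)
  obtain ⟨k, hk⟩ := htors u
  induction k generalizing u with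
  | zero =>
    refine ⟨0, W.zero_mem, 0, W.zero_mem, map_zero _, ?_⟩
    simpa using hk
  | succ k ih =>
    rcases Nat.eq_zero_or_pos k with rfl | hkpos
    · exact ⟨u, hu, 0, W.zero_mem, by simpa using hk, by simp⟩
    have hk0 : (k : K) ≠ 0 := by exact_mod_cast hkpos.ne'
    -- Since `g^(k+1) u = 0`, the commutator gives `g^k d (g b u) = -k g^(k-1) g' g b u = -k g^k (1
    -- - a g) u = -k g^k u`. With this `v`, the element `u - d v` is therefore killed by `g^k`.
    set v : N := -(k : K)⁻¹ • aeval x (g * b) u with hv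
    have hvW : v ∈ W := W.smul_mem _ (hWp _ _ hu)
    have key : aeval x (g ^ k) (d (aeval x (g * b) u)) = -(k : K) • aeval x (g ^ k) u := by
      have h1 := congrArg (fun φ : Module.End K N => φ (aeval x (g * b) u))
        (weyl_commutator h (g ^ k))
      have h2 : ∀ p q : K[X], aeval x p (aeval x q u) = aeval x (p * q) u := fun p q => by
        rw [map_mul, Module.End.mul_apply]
      have h3 : aeval x (g ^ k) (aeval x (g * b) u) = 0 := by
        rw [h2, show g ^ k * (g * b) = b * g ^ (k + 1) by ring, ← h2, hk, map_zero]
      simp only [Module.End.mul_apply, LinearMap.add_apply, h3, map_zero, h2] at h1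
      rw [eq_neg_of_add_eq_zero_left h1.symm, derivative_pow]
      have h4 : C (k : K) * g ^ (k - 1) * derivative g * (g * b) =
          (k : K) • g ^ k + (-(k : K)) • (a * g ^ (k + 1)) := by
        have : g ^ k = g ^ (k - 1) * g := by rw [← pow_succ, Nat.sub_add_cancel hkpos]
        rw [smul_eq_C_mul, smul_eq_C_mul, map_neg, pow_succ, this]
        linear_combination (C (k : K) * (g ^ (k - 1) * g)) * hab
      have h5 : aeval x (a * g ^ (k + 1)) u = 0 := by rw [← h2, hk, map_zero]
      rw [h4, map_add, map_smul, map_smul, LinearMap.add_apply, LinearMap.smul_apply,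
        LinearMap.smul_apply, h5, smul_zero, add_zero, neg_smul]
    obtain ⟨w, hw, v', hv', hgw, hsum⟩ := ih (u := u - d v) (W.sub_mem hu (hWd _ hvW)) (by
      rw [map_sub, hv, map_smul, map_smul, key, smul_smul]
      simp [hk0])
    exact ⟨w, hw, v' + v, W.add_mem hv' hvW, hgw, by rw [map_add, ← add_assoc, ← hsum]; abel⟩

end Weyl

/-! ### Several commuting pairs of Weyl operators -/

section WeylMulti

open Polynomial

variable {K : Type*} [Field K] {N : Type*} [AddCommGroup N] [Module K N] {n : ℕ}
  {x d : Fin n → Module.End K N} {g : Fin n → K[X]}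

/-- The common kernel of the operators `g_i(x_i)`, for `i ∈ U`. -/
def commonKer (x : Fin n → Module.End K N) (g : Fin n → K[X]) (U : Finset (Fin n)) :
    Submodule K N := ⨅ i ∈ U, LinearMap.ker (aeval (x i) (g i))

theorem mem_commonKer {U : Finset (Fin n)} {v : N} :
    v ∈ commonKer x g U ↔ ∀ i ∈ U, aeval (x i) (g i) v = 0 := by
  simp [commonKer]

theorem commonKer_invariant {U : Finset (Fin n)} {φ : Module.End K N}
    (hφ : ∀ i ∈ U, φ * x i = x i * φ) {v : N} (hv : v ∈ commonKer x g U) :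
    φ v ∈ commonKer x g U := by
  rw [mem_commonKer] at hv ⊢
  intro i hi
  have hc : Commute φ (aeval (x i) (g i)) := by
    rw [aeval_eq_sum_range]
    exact Commute.sum_right _ _ _ fun k _ =>
      Commute.smul_right (Commute.pow_right (hφ i hi) k) _
  rw [← Module.End.mul_apply, ← hc.eq, Module.End.mul_apply, hv i hi, map_zero]

theorem rangeSum_invariant {D : Fin n → N →+ N} {U : Finset (Fin n)} {φ : N →+ N}
    (hφ : ∀ i ∈ U, ∀ v, φ (D i v) = D i (φ v)) {v : N} (hv : v ∈ rangeSum D U) :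
    φ v ∈ rangeSum D U := by
  have : rangeSum D U ≤ (rangeSum D U).comap φ := by
    refine iSup₂_le fun i hi => ?_
    rintro _ ⟨y, rfl⟩
    exact (le_iSup₂_of_le (f := fun i (_ : i ∈ U) => (D i).range) i hi le_rfl)
      ⟨φ y, (hφ i hi y).symm⟩
  exact this hv

variable [CharZero K] (hdd : ∀ i j, d i * d j = d j * d i) (hxx : ∀ i j, x i * x j = x j * x i)
  (hdx : ∀ i j, i ≠ j → d i * x j = x j * d i) (h : ∀ i, d i * x i - x i * d i = 1)
  (hg : ∀ i, (g i).Separable) (htors : ∀ i (v : N), ∃ k, aeval (x i) (g i ^ k) v = 0)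

include hdd hxx hdx h hg htors

/-- `N = (⋂_{i ∈ U} ker g_i(x_i)) ⊕ ∑_{i ∈ U} d_i N`. -/
theorem weyl_decomposition (U : Finset (Fin n)) :
    (∀ v, ∃ w ∈ commonKer x g U, v - w ∈ rangeSum (fun i => (d i).toAddMonoidHom) U) ∧
    ∀ w ∈ commonKer x g U, w ∈ rangeSum (fun i => (d i).toAddMonoidHom) U → w = 0 := by
  induction U using Finset.induction_on with
  | empty =>
    simp only [commonKer, rangeSum, Finset.notMem_empty, iInf_false, iInf_top, iSup_false,
      iSup_bot, AddSubgroup.mem_bot]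
    exact ⟨fun v => ⟨v, trivial, sub_self v⟩, fun w _ hw => hw⟩
  | insert i U hi ih =>
    set D : Fin n → N →+ N := fun i => (d i).toAddMonoidHom with hD
    obtain ⟨ih1, ih2⟩ := ih
    have hne : ∀ j ∈ U, i ≠ j := fun j hj hij => hi (hij ▸ hj)
    have hWx : ∀ w ∈ commonKer x g U, x i w ∈ commonKer x g U := fun w hw =>
      commonKer_invariant (fun j _ => hxx i j) hw
    have hWd : ∀ w ∈ commonKer x g U, d i w ∈ commonKer x g U := fun w hw =>
      commonKer_invariant (fun j hj => hdx i j (hne j hj)) hw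
    have hS : ∀ v ∈ rangeSum D U, d i v ∈ rangeSum D U := fun v hv =>
      rangeSum_invariant (φ := (d i).toAddMonoidHom)
        (fun j _ v => congrArg (fun φ : Module.End K N => φ v) (hdd i j)) hv
    have hsup : rangeSum D (insert i U) = (D i).range ⊔ rangeSum D U := by
      rw [rangeSum, Finset.iSup_insert, rangeSum]
    constructor
    · intro v
      obtain ⟨w, hw, hvw⟩ := ih1 v
      obtain ⟨w', hw', y, hy, hgw', rfl⟩ := weyl_span (h i) (hg i) hWx hWd (htors i) hw
      refine ⟨w', ?_, ?_⟩
      · rw [mem_commonKer] at hw' ⊢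
        intro j hj
        rcases Finset.mem_insert.1 hj with rfl | hj
        exacts [hgw', hw' j hj]
      · rw [hsup, show v - w' = d i y + (v - (w' + d i y)) by abel]
        exact AddSubgroup.add_mem_sup ⟨y, rfl⟩ hvw
    · intro w hw hws
      rw [hsup] at hws
      obtain ⟨_, ⟨y, rfl⟩, s, hs, hys⟩ := AddSubgroup.mem_sup.1 hws
      rw [mem_commonKer] at hw
      have hwU : w ∈ commonKer x g U := mem_commonKer.2 fun j hj =>
        hw j (Finset.mem_insert_of_mem hj)
      -- Replace `y` by its component `w'` in the common kernel for `U`. Then `w - d i w'` lies in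
      -- both summands for `U`, so `w = d i w'`, and `weyl_disjoint` kills `w'`.
      obtain ⟨w', hw', hyw⟩ := ih1 y
      have hys : d i y + s = w := hys
      have h0 : w - d i w' = 0 := by
        refine ih2 _ (Submodule.sub_mem _ hwU (hWd _ hw')) ?_
        rw [← hys, show d i y + s - d i w' = d i (y - w') + s by rw [map_sub]; abel]
        exact add_mem (hS _ hyw) hs
      have hgw := hw i (Finset.mem_insert_self _ _)
      rw [sub_eq_zero.1 h0] at hgw ⊢
      rw [weyl_disjoint (h i) (hg i) (htors i) hgw, map_zero]

/-- The operators `d_i` form a regular sequence on `N`. -/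
theorem weyl_regular {U : Finset (Fin n)} {i : Fin n} (hi : i ∉ U) {v : N}
    (hv : d i v ∈ rangeSum (fun i => (d i).toAddMonoidHom) U) :
    v ∈ rangeSum (fun i => (d i).toAddMonoidHom) U := by
  obtain ⟨h1, h2⟩ := weyl_decomposition hdd hxx hdx h hg htors U
  obtain ⟨w, hw, hvw⟩ := h1 v
  have hne : ∀ j ∈ U, i ≠ j := fun j hj hij => hi (hij ▸ hj)
  -- `d i` preserves both summands of the decomposition for `U`, so the component `w` of `v` in the
  -- common kernel is sent to zero, and `d i` is injective.
  have hdw : d i w = 0 := by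
    refine h2 _ (commonKer_invariant (fun j hj => hdx i j (hne j hj)) hw) ?_
    rw [show d i w = d i v - d i (v - w) by rw [map_sub]; abel]
    exact sub_mem hv (rangeSum_invariant (φ := (d i).toAddMonoidHom)
        (fun j _ v => congrArg (fun φ : Module.End K N => φ v) (hdd i j)) hvw)
  rw [weyl_injective (h i) (hg i) (htors i) hdw, sub_zero] at hvw
  exact hvw

end WeylMulti

/-! ### De Rham cohomology of modules over the Weyl algebra with finite support -/

section DeRham

variable {K : Type u} [Field K] {N : Type u} [AddCommGroup N] [Module K N] {n : ℕ}

theorem sgn_smul {M : Type*} [AddCommGroup M] [Module K M] {s : ℕ} (T : Finset (Fin s))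
    (i : Fin s) (x : M) : sgn K T i • x = ((-1 : ℤ) ^ (T.filter (· < i)).card) • x := by
  rw [sgn, ← Int.cast_smul_eq_zsmul K]
  simp

/-- Extension of a `p`-cochain by zero to all subsets. -/
def extendZero {s p : ℕ} {A : Finset (Fin s) → Type*} [∀ S, Zero (A S)]
    (c : ∀ S : Subsets s p, A S.1) (S : Finset (Fin s)) : A S :=
  if h : S.card = p then c ⟨S, h⟩ else 0

theorem extendZero_apply {s p : ℕ} {A : Finset (Fin s) → Type*} [∀ S, Zero (A S)]
    (c : ∀ S : Subsets s p, A S.1) (S : Subsets s p) : extendZero c S.1 = c S :=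
  dif_pos S.2

theorem deRhamDiff_apply (del : Fin n → N →ₗ[K] N) {p : ℕ} (ω : Finset (Fin n) → N)
    (T : Subsets n (p + 1)) :
    deRhamDiff del p (fun S => ω S.1) T = altSum (fun i => (del i).toAddMonoidHom) ω T.1 := by
  rw [altSum, ← Finset.sum_coe_sort]
  exact Finset.sum_congr rfl fun i _ => sgn_smul _ _ _

theorem exists_eq_restrict {p : ℕ} (c : Subsets n p → N) :
    ∃ ω : Finset (Fin n) → N, c = fun S => ω S.1 :=
  ⟨extendZero (A := fun _ => N) c, funext fun S => (extendZero_apply (A := fun _ => N) c S).symm⟩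

/-- One description serves all degrees: in degree zero the alternating sum over the empty set
vanishes, which matches the convention that there are no nonzero coboundaries. -/
theorem mem_coboundaries_deRhamDiff (del : Fin n → N →ₗ[K] N) {p : ℕ} (c : Subsets n p → N) :
    c ∈ coboundaries (C := fun p => Subsets n p → N) (deRhamDiff del) p ↔
      ∃ γ : Finset (Fin n) → N,
        ∀ S : Subsets n p, altSum (fun i => (del i).toAddMonoidHom) γ S.1 = c S := by
  cases p with
  | zero =>
    have h0 : ∀ (γ : Finset (Fin n) → N) (S : Subsets n 0),
        altSum (fun i => (del i).toAddMonoidHom) γ S.1 = 0 := fun γ S => by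
      rw [Finset.card_eq_zero.1 S.2]
      simp [altSum]
    simp only [h0, exists_const]
    exact (Submodule.mem_bot K).trans (funext_iff.trans (forall_congr' fun S => eq_comm))
  | succ p =>
    refine ⟨?_, ?_⟩
    · rintro ⟨b, rfl⟩
      obtain ⟨γ, rfl⟩ := exists_eq_restrict b
      exact ⟨γ, fun S => (deRhamDiff_apply del γ S).symm⟩
    · rintro ⟨γ, hγ⟩
      exact ⟨fun S => γ S.1, funext fun S => (deRhamDiff_apply del γ S).trans (hγ S)⟩

variable [CharZero K] {x d : Fin n → Module.End K N} {g : Fin n → Polynomial K}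
  (hdd : ∀ i j, d i * d j = d j * d i) (hxx : ∀ i j, x i * x j = x j * x i)
  (hdx : ∀ i j, i ≠ j → d i * x j = x j * d i) (h : ∀ i, d i * x i - x i * d i = 1)
  (hg : ∀ i, (g i).Separable)
  (htors : ∀ i (v : N), ∃ k, Polynomial.aeval (x i) (g i ^ k) v = 0)

include hdd hxx hdx h hg htors

theorem deRhamCohomology_subsingleton {p : ℕ} (hp : p < n) :
    Subsingleton (DeRhamCohomology d p) := by
  rw [Submodule.Quotient.subsingleton_iff, Submodule.submoduleOf_eq_top]
  intro c hc
  obtain ⟨ω, rfl⟩ := exists_eq_restrict c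
  obtain ⟨γ, hγ⟩ := exists_altSum_eq_of_regular (fun i => (d i).toAddMonoidHom)
    (fun i j v => congrArg (fun φ : Module.End K N => φ v) (hdd i j)) Finset.univ
    (fun i _ v hv => weyl_regular hdd hxx hdx h hg htors (by simp) hv) p (by simpa using hp) ω
    (fun T _ hT => by
      rw [LinearMap.mem_ker] at hc
      rw [← deRhamDiff_apply d ω ⟨T, hT⟩, hc]
      rfl)
  exact (mem_coboundaries_deRhamDiff d _).2 ⟨γ, fun S => hγ S.1 (Finset.subset_univ _) S.2⟩

/-- The top de Rham cohomology is the common kernel of the operators `g_i(x_i)`. -/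
theorem deRhamCohomology_top_equiv :
    Nonempty (commonKer x g Finset.univ ≃ₗ[K] DeRhamCohomology d n) := by
  have hempty : ∀ S : Subsets n (n + 1), False := fun S => by
    have := S.1.card_le_univ
    rw [S.2, Fintype.card_fin] at this
    omega
  have huniv : ∀ S : Subsets n n, S.1 = Finset.univ := fun S =>
    Finset.card_eq_iff_eq_univ _ |>.1 (by rw [S.2, Fintype.card_fin])
  obtain ⟨h1, h2⟩ := weyl_decomposition hdd hxx hdx h hg htors Finset.univ
  -- There is exactly one `n`-element subset and none with `n + 1` elements, so a top cochain is one
  -- element of `N` and is automatically a cocycle.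
  let φ : N →ₗ[K] LinearMap.ker (deRhamDiff d n) :=
    (LinearMap.pi fun _ => LinearMap.id).codRestrict _ fun v => by
      rw [LinearMap.mem_ker]
      exact funext fun S => (hempty S).elim
  let ψ : commonKer x g Finset.univ →ₗ[K] DeRhamCohomology d n :=
    Submodule.mkQ _ ∘ₗ φ ∘ₗ Submodule.subtype _
  have hφ : ∀ v, φ v ∈ (coboundaries (C := fun p => Subsets n p → N) (deRhamDiff d) n).submoduleOf
      (LinearMap.ker (deRhamDiff d n)) ↔
      v ∈ rangeSum (fun i => (d i).toAddMonoidHom) Finset.univ := by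
    intro v
    refine (mem_coboundaries_deRhamDiff d _).trans ⟨?_, ?_⟩
    · rintro ⟨γ, hγ⟩
      have := hγ ⟨Finset.univ, Finset.card_fin n⟩
      rw [← show _ = v from this]
      exact altSum_mem_rangeSum _ _ _
    · intro hv
      obtain ⟨γ, hγ⟩ := exists_altSum_eq _ hv
      exact ⟨γ, fun S => by rw [huniv S, hγ]; rfl⟩
  refine ⟨LinearEquiv.ofBijective ψ ⟨?_, ?_⟩⟩
  · rw [← LinearMap.ker_eq_bot, LinearMap.ker_eq_bot']
    rintro ⟨w, hw⟩ hψ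
    have := (hφ w).1 ((Submodule.Quotient.mk_eq_zero _).1 hψ)
    exact Subtype.ext (h2 w hw this)
  · intro z
    obtain ⟨⟨c, hc⟩, rfl⟩ := Submodule.mkQ_surjective _ z
    obtain ⟨w, hw, hcw⟩ := h1 (c ⟨Finset.univ, Finset.card_fin n⟩)
    refine ⟨⟨w, hw⟩, ?_⟩
    have hc' : (⟨c, hc⟩ : LinearMap.ker (deRhamDiff d n)) = φ (c ⟨Finset.univ, Finset.card_fin n⟩) :=
      Subtype.ext (funext fun S => congrArg c (Subtype.ext (huniv S)))
    symm
    rw [hc']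
    refine (Submodule.Quotient.eq _).2 ?_
    have := (hφ _).2 hcw
    rwa [map_sub] at this

end DeRham

/-! ### Čech complexes with coefficients in a module -/

section CechModule

variable {R : Type*} [CommRing R] {s : ℕ} (f : Fin s → R)

/-- The powers of `f_S = ∏_{i ∈ S} f_i`. -/
abbrev prodPowers (S : Finset (Fin s)) : Submonoid R := Submonoid.powers (∏ i ∈ S, f i)

variable {M : Type*} [AddCommGroup M] [Module R M] {A : Finset (Fin s) → Type*}
  [∀ S, AddCommGroup (A S)] [∀ S, Module R (A S)] (ι : ∀ S, M →ₗ[R] A S)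
  [hι : ∀ S, IsLocalizedModule (prodPowers f S) (ι S)]

include ι hι in
theorem isUnit_prodPowers {S T : Finset (Fin s)} (h : S ⊆ T) (x : prodPowers f S) :
    IsUnit (algebraMap R (Module.End R (A T)) x) := by
  obtain ⟨_, k, rfl⟩ := x
  obtain ⟨c, hc⟩ := Finset.prod_dvd_prod_of_subset S T f h
  have h1 := IsLocalizedModule.map_units (S := prodPowers f T) (ι T) ⟨_, k, rfl⟩
  have h2 : (∏ i ∈ T, f i) ^ k = (∏ i ∈ S, f i) ^ k * c ^ k := by rw [hc, mul_pow]
  simp only [h2, map_mul] at h1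
  exact ((Algebra.commute_algebraMap_left _ _).isUnit_mul_iff.1 h1).1

/-- The canonical map `M_{f_S} → M_{f_T}` for `S ⊆ T`. -/
def locRes {S T : Finset (Fin s)} (h : S ⊆ T) : A S →ₗ[R] A T :=
  IsLocalizedModule.lift (prodPowers f S) (ι S) (ι T) (isUnit_prodPowers f ι h)

@[simp]
theorem locRes_apply {S T : Finset (Fin s)} (h : S ⊆ T) (m : M) :
    locRes f ι h (ι S m) = ι T m :=
  IsLocalizedModule.lift_apply _ _ _ _ _

theorem locRes_unique {S T : Finset (Fin s)} (h : S ⊆ T) (φ : A S →ₗ[R] A T)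
    (hφ : ∀ m, φ (ι S m) = ι T m) : locRes f ι h = φ :=
  IsLocalizedModule.lift_unique _ _ _ _ _ (LinearMap.ext hφ)

theorem locRes_locRes {S T U : Finset (Fin s)} (h : S ⊆ T) (h' : T ⊆ U) (x : A S) :
    locRes f ι h' (locRes f ι h x) = locRes f ι (h.trans h') x := by
  have := locRes_unique f ι (h.trans h') (locRes f ι h' ∘ₗ locRes f ι h) (by simp)
  rw [this]
  rfl

include hι in
theorem exists_smul_eq_loc {S : Finset (Fin s)} (x : A S) :
    ∃ (k : ℕ) (m : M), ((∏ i ∈ S, f i) ^ k) • x = ι S m := by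
  obtain ⟨⟨m, ⟨_, k, rfl⟩⟩, h⟩ := IsLocalizedModule.surj (prodPowers f S) (ι S) x
  exact ⟨k, m, h⟩

include hι in
theorem loc_eq_zero_iff {S : Finset (Fin s)} {m : M} :
    ι S m = 0 ↔ ∃ k : ℕ, ((∏ i ∈ S, f i) ^ k) • m = 0 := by
  rw [IsLocalizedModule.eq_zero_iff (prodPowers f S) (ι S)]
  constructor
  · rintro ⟨⟨_, k, rfl⟩, h⟩
    exact ⟨k, h⟩
  · rintro ⟨k, h⟩
    exact ⟨⟨_, k, rfl⟩, h⟩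

include ι hι in
theorem prod_pow_smul_bijective {S T : Finset (Fin s)} (h : S ⊆ T) (k : ℕ) :
    Function.Bijective fun x : A T => ((∏ i ∈ S, f i) ^ k) • x :=
  (Module.End.isUnit_iff _).1 (isUnit_prodPowers f ι h ⟨_, k, rfl⟩)

/-- `A (insert i S)` is the localization of `A S` at `f i`. This lemma and the next are the
surjectivity and kernel halves of that fact, read off from the localizations of `M`. -/
theorem exists_locRes_eq_smul {S : Finset (Fin s)} {i : Fin s} (hi : i ∉ S)
    (y : A (insert i S)) :
    ∃ (k : ℕ) (x : A S), locRes f ι (Finset.subset_insert i S) x = f i ^ k • y := by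
  obtain ⟨k, m, hm⟩ := exists_smul_eq_loc f ι y
  obtain ⟨x, hx⟩ := (prod_pow_smul_bijective f ι (subset_refl S) k).2 (ι S m)
  refine ⟨k, x, (prod_pow_smul_bijective f ι (Finset.subset_insert i S) k).1 ?_⟩
  simp only at hx ⊢
  rw [← map_smul, hx, locRes_apply, ← hm, Finset.prod_insert hi, smul_smul, mul_pow, mul_comm]

theorem exists_smul_eq_zero_of_locRes {S : Finset (Fin s)} {i : Fin s} (hi : i ∉ S) (x : A S)
    (hx : locRes f ι (Finset.subset_insert i S) x = 0) : ∃ k : ℕ, f i ^ k • x = 0 := by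
  obtain ⟨k, m, hm⟩ := exists_smul_eq_loc f ι x
  have h1 : ι (insert i S) m = 0 := by
    rw [← locRes_apply f ι (Finset.subset_insert i S), ← hm, map_smul, hx, smul_zero]
  obtain ⟨l, hl⟩ := (loc_eq_zero_iff f ι).1 h1
  refine ⟨l, (prod_pow_smul_bijective f ι (subset_refl S) (l + k)).1 ?_⟩
  simp only [smul_zero]
  rw [smul_comm, pow_add, mul_smul, hm, ← map_smul, ← map_smul, smul_smul, ← mul_pow,
    ← Finset.prod_insert hi, hl, map_zero]

/-- The Čech differential on all cochains at once. -/
def totalDiff : (∀ S, A S) →ₗ[R] (∀ S, A S) where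
  toFun c T := ∑ i : {i // i ∈ T},
    ((-1 : ℤ) ^ (T.filter (· < i.1)).card) • locRes f ι (T.erase_subset i.1) (c (T.erase i.1))
  map_add' c c' := by
    funext T
    simp [Finset.sum_add_distrib]
  map_smul' r c := by
    funext T
    simp [Finset.smul_sum, smul_comm r]

theorem totalDiff_apply (c : ∀ S, A S) (T : Finset (Fin s)) :
    totalDiff f ι c T = ∑ i : {i // i ∈ T},
      ((-1 : ℤ) ^ (T.filter (· < i.1)).card) • locRes f ι (T.erase_subset i.1) (c (T.erase i.1)) :=
  rfl

theorem totalDiff_congr {c c' : ∀ S, A S} {T : Finset (Fin s)}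
    (h : ∀ i ∈ T, c (T.erase i) = c' (T.erase i)) : totalDiff f ι c T = totalDiff f ι c' T := by
  rw [totalDiff_apply, totalDiff_apply]
  refine Finset.sum_congr rfl fun i _ => ?_
  rw [h i.1 i.2]

/-- After restriction to one `A T` all summands lie in the same module, so `d² = 0` reduces to
`altSum_altSum` for identity operators. -/
theorem totalDiff_eq_altSum (c : ∀ S, A S) {S T : Finset (Fin s)} (h : S ⊆ T) :
    locRes f ι h (totalDiff f ι c S) = altSum (fun _ => AddMonoidHom.id (A T))
      (fun S => if h : S ⊆ T then locRes f ι h (c S) else 0) S := by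
  rw [totalDiff_apply, map_sum, altSum, ← Finset.sum_coe_sort S]
  refine Finset.sum_congr rfl fun i _ => ?_
  rw [map_zsmul, locRes_locRes, dif_pos ((S.erase_subset i.1).trans h)]
  rfl

theorem totalDiff_totalDiff (c : ∀ S, A S) (T : Finset (Fin s)) :
    totalDiff f ι (totalDiff f ι c) T = 0 := by
  have hid : locRes f ι (subset_refl T) = LinearMap.id := locRes_unique f ι _ _ fun _ => rfl
  have h1 := totalDiff_eq_altSum f ι (totalDiff f ι c) (subset_refl T)
  rw [hid, LinearMap.id_apply] at h1
  rw [h1, ← altSum_altSum (fun _ => AddMonoidHom.id (A T)) (fun _ _ _ => rfl)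
    (fun S => if h : S ⊆ T then locRes f ι h (c S) else 0) T]
  refine altSum_congr _ fun i hi => ?_
  rw [dif_pos (T.erase_subset i), totalDiff_eq_altSum]

/-- If `c` vanishes on all `T \ {j}` with `j ≠ i`, only one term of the differential survives. -/
theorem totalDiff_single {c : ∀ S, A S} {S : Finset (Fin s)} {i : Fin s} (hi : i ∉ S)
    (hc : ∀ T, i ∈ T → c T = 0) :
    totalDiff f ι c (insert i S) = ((-1 : ℤ) ^ ((insert i S).filter (· < i)).card) •
      locRes f ι (Finset.subset_insert i S) (c S) := by
  rw [totalDiff_apply, Finset.sum_eq_single ⟨i, Finset.mem_insert_self i S⟩]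
  · have key : ∀ (S' : Finset (Fin s)) (h : S' ⊆ insert i S), S' = S →
        locRes f ι h (c S') = locRes f ι (Finset.subset_insert i S) (c S) := by
      rintro S' h rfl
      rfl
    simp only
    rw [key _ _ (Finset.erase_insert hi)]
  · intro j _ hj
    rw [hc, map_zero, smul_zero]
    exact Finset.mem_erase.2 ⟨fun h => hj (Subtype.ext h.symm), Finset.mem_insert_self _ _⟩
  · exact fun h => (h (Finset.mem_univ _)).elim

/-- Čech cohomology is killed by powers of the `f_i`. -/
theorem exists_smul_eq_totalDiff (i : Fin s) {p : ℕ} {c : ∀ S, A S}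
    (hc : ∀ T : Finset (Fin s), T.card = p + 1 → totalDiff f ι c T = 0) :
    ∃ (k : ℕ) (b : ∀ S, A S), ∀ S : Finset (Fin s), S.card = p →
      f i ^ k • c S = totalDiff f ι b S := by
  classical
  have h1 : ∀ S : Finset (Fin s), ∃ (k : ℕ) (x : A S), i ∉ S →
      locRes f ι (Finset.subset_insert i S) x = f i ^ k • c (insert i S) := by
    intro S
    by_cases hi : i ∈ S
    · exact ⟨0, 0, fun h => (h hi).elim⟩
    · obtain ⟨k, x, hx⟩ := exists_locRes_eq_smul f ι hi (c (insert i S))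
      exact ⟨k, x, fun _ => hx⟩
  choose k x hx using h1
  let m := Finset.univ.sup k
  have hm : ∀ S, k S ≤ m := fun S => Finset.le_sup (Finset.mem_univ S)
  -- A contracting homotopy for the index `i`, available only up to a power of `f i`: `b S` is `± c
  -- (insert i S)` with its `f i`-denominator cleared. The exponent `m` is uniform because there are
  -- finitely many `S`.
  let b : ∀ S, A S := fun S => if i ∈ S then 0 else
    ((-1 : ℤ) ^ ((insert i S).filter (· < i)).card) • (f i ^ (m - k S)) • x S
  have hb0 : ∀ T, i ∈ T → b T = 0 := fun T hT => if_pos hT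
  have hb : ∀ S, i ∉ S → totalDiff f ι b (insert i S) = f i ^ m • c (insert i S) := by
    intro S hi
    rw [totalDiff_single f ι hi hb0]
    simp only [b]
    rw [if_neg hi, map_zsmul, map_smul, hx S hi, smul_smul, ← mul_pow, smul_smul, ← pow_add,
      Nat.sub_add_cancel (hm S)]
    simp
  let e : ∀ S, A S := f i ^ m • c - totalDiff f ι b
  have he0 : ∀ T, i ∈ T → e T = 0 := by
    intro T hT
    obtain ⟨S, hS, rfl⟩ : ∃ S, i ∉ S ∧ insert i S = T :=
      ⟨T.erase i, Finset.notMem_erase _ _, Finset.insert_erase hT⟩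
    simp [e, hb S hS]
  -- The error `e` lives on sets without `i`, so the cocycle condition at `insert i S` says that `e
  -- S` dies after inverting `f i`.
  have h2 : ∀ S : Finset (Fin s), ∃ l : ℕ, i ∉ S → S.card = p → f i ^ l • e S = 0 := by
    intro S
    by_cases hi : i ∈ S
    · exact ⟨0, fun h => (h hi).elim⟩
    by_cases hp : S.card = p
    · have h3 : totalDiff f ι e (insert i S) = 0 := by
        have h4 : totalDiff f ι e = f i ^ m • totalDiff f ι c -
            totalDiff f ι (totalDiff f ι b) := by simp only [e, map_sub, map_smul]
        rw [h4, Pi.sub_apply, Pi.smul_apply, totalDiff_totalDiff,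
          hc _ (by rw [Finset.card_insert_of_notMem hi, hp]), smul_zero, sub_zero]
      rw [totalDiff_single f ι hi he0] at h3
      have h5 : locRes f ι (Finset.subset_insert i S) (e S) = 0 := by
        have := congrArg (fun y => ((-1 : ℤ) ^ ((insert i S).filter (· < i)).card) • y) h3
        simpa [smul_smul, ← mul_pow] using this
      obtain ⟨l, hl⟩ := exists_smul_eq_zero_of_locRes f ι hi _ h5
      exact ⟨l, fun _ _ => hl⟩
    · exact ⟨0, fun _ h => (hp h).elim⟩
  choose l hl using h2
  let q := Finset.univ.sup l
  have hq : ∀ S, l S ≤ q := fun S => Finset.le_sup (Finset.mem_univ S)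
  refine ⟨q + m, f i ^ q • b, fun S hS => ?_⟩
  have h6 : f i ^ q • e S = 0 := by
    by_cases hi : i ∈ S
    · rw [he0 S hi, smul_zero]
    · rw [← Nat.sub_add_cancel (hq S), pow_add, mul_smul, hl S hi hS, smul_zero]
  simp only [e, Pi.sub_apply, Pi.smul_apply, smul_sub, sub_eq_zero] at h6
  rw [map_smul, Pi.smul_apply, ← h6, pow_add, mul_smul]

end CechModule

/-! ### Multiplication by a regular element on the cohomology of a complex -/

section ModuleCohomology

variable {R : Type*} [CommRing R] {C : ℕ → Type*} [∀ p, AddCommGroup (C p)] [∀ p, Module R (C p)]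

/-- The coboundaries of a cochain complex of `R`-modules. -/
def modCoboundaries (d : ∀ p, C p →ₗ[R] C (p + 1)) : ∀ p, Submodule R (C p)
  | 0 => ⊥
  | p + 1 => LinearMap.range (d p)

/-- The cohomology of a cochain complex of `R`-modules. -/
abbrev ModCohomology (d : ∀ p, C p →ₗ[R] C (p + 1)) (p : ℕ) : Type _ :=
  LinearMap.ker (d p) ⧸ (modCoboundaries d p).submoduleOf (LinearMap.ker (d p))

theorem modCohomology_subsingleton_iff (d : ∀ p, C p →ₗ[R] C (p + 1)) (p : ℕ) :
    Subsingleton (ModCohomology d p) ↔ ∀ c, d p c = 0 → c ∈ modCoboundaries d p := by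
  rw [Submodule.Quotient.subsingleton_iff, Submodule.submoduleOf_eq_top]
  rfl

variable {C' : ℕ → Type*} [∀ p, AddCommGroup (C' p)] [∀ p, Module R (C' p)]

theorem map_mem_modCoboundaries {d : ∀ p, C p →ₗ[R] C (p + 1)} {d' : ∀ p, C' p →ₗ[R] C' (p + 1)}
    {π : ∀ p, C p →ₗ[R] C' p} (hπ : ∀ p c, π (p + 1) (d p c) = d' p (π p c)) {p : ℕ} {c : C p}
    (hc : c ∈ modCoboundaries d p) : π p c ∈ modCoboundaries d' p := by
  cases p with
  | zero =>
    rw [show c = 0 from hc, map_zero]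
    exact Submodule.zero_mem _
  | succ p =>
    obtain ⟨b, rfl⟩ := hc
    exact ⟨π p b, (hπ p b).symm⟩

theorem exists_mem_modCoboundaries {d : ∀ p, C p →ₗ[R] C (p + 1)}
    {d' : ∀ p, C' p →ₗ[R] C' (p + 1)} {π : ∀ p, C p →ₗ[R] C' p}
    (hπ : ∀ p c, π (p + 1) (d p c) = d' p (π p c)) (hsurj : ∀ p, Function.Surjective (π p))
    {p : ℕ} {c : C' p} (hc : c ∈ modCoboundaries d' p) : ∃ b ∈ modCoboundaries d p, π p b = c := by
  cases p with
  | zero =>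
    rw [show c = 0 from hc]
    exact ⟨0, Submodule.zero_mem _, map_zero _⟩
  | succ p =>
    obtain ⟨b, rfl⟩ := hc
    obtain ⟨a, rfl⟩ := hsurj p b
    exact ⟨d p a, ⟨a, rfl⟩, hπ p a⟩

theorem diff_eq_zero_of_mem_modCoboundaries {d : ∀ p, C p →ₗ[R] C (p + 1)}
    (hd : ∀ p c, d (p + 1) (d p c) = 0) {p : ℕ} {c : C p} (hc : c ∈ modCoboundaries d p) :
    d p c = 0 := by
  cases p with
  | zero => rw [show c = 0 from hc, map_zero]
  | succ p =>
    obtain ⟨b, rfl⟩ := hc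
    exact hd p b

/-- For a short exact sequence of complexes `0 → C → C → C' → 0` whose first map is multiplication
by `g`, if `H^p(C) = 0` then the connecting map identifies `H^p(C')` with the kernel of `g` on
`H^{p+1}(C)`. -/
theorem exists_connecting {d : ∀ p, C p →ₗ[R] C (p + 1)} {d' : ∀ p, C' p →ₗ[R] C' (p + 1)}
    (hd : ∀ p c, d (p + 1) (d p c) = 0)
    {π : ∀ p, C p →ₗ[R] C' p} (hπ : ∀ p c, π (p + 1) (d p c) = d' p (π p c))
    (hsurj : ∀ p, Function.Surjective (π p)) (g : R)
    (hg : ∀ p (c : C p), g • c = 0 → c = 0)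
    (hex : ∀ p (c : C p), π p c = 0 ↔ ∃ b, g • b = c) {p : ℕ}
    (hp : Subsingleton (ModCohomology d p)) :
    ∃ δ : ModCohomology d' p →ₗ[R] ModCohomology d (p + 1), Function.Injective δ ∧
      ∀ z, z ∈ LinearMap.range δ ↔ g • z = 0 := by
  rw [modCohomology_subsingleton_iff] at hp
  have hginj : ∀ p (a b : C p), g • a = g • b → a = b := fun p a b h =>
    sub_eq_zero.1 (hg p _ (by rw [smul_sub, h, sub_self]))
  have hπg : ∀ p (c : C p), π p (g • c) = 0 := fun p c => (hex p _).2 ⟨c, rfl⟩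
  -- pairs `(c, b)` with `d c = g b`
  let E : Submodule R (C p × C (p + 1)) :=
    LinearMap.ker ((d p) ∘ₗ LinearMap.fst R _ _ - g • LinearMap.snd R (C p) (C (p + 1)))
  have hE : ∀ x : E, d p x.1.1 = g • x.1.2 := fun x => by
    have := x.2
    rw [LinearMap.mem_ker] at this
    exact sub_eq_zero.1 this
  let r : E →ₗ[R] ModCohomology d (p + 1) := Submodule.mkQ _ ∘ₗ
    (LinearMap.snd R (C p) (C (p + 1)) ∘ₗ E.subtype).codRestrict (LinearMap.ker (d (p + 1)))
      (fun x => by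
        rw [LinearMap.mem_ker]
        refine hg _ _ ?_
        rw [← map_smul]
        change d (p + 1) (g • x.1.2) = 0
        rw [← hE x, hd])
  let q : E →ₗ[R] ModCohomology d' p := Submodule.mkQ _ ∘ₗ
    (π p ∘ₗ LinearMap.fst R (C p) (C (p + 1)) ∘ₗ E.subtype).codRestrict (LinearMap.ker (d' p))
      (fun x => by
        rw [LinearMap.mem_ker]
        change d' p (π p x.1.1) = 0
        rw [← hπ, hE x, hπg])
  have hr0 : ∀ x : E, r x = 0 ↔ ∃ c', d p c' = x.1.2 := fun x =>
    (Submodule.Quotient.mk_eq_zero _).trans Iff.rfl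
  have hq0 : ∀ x : E, q x = 0 ↔ π p x.1.1 ∈ modCoboundaries d' p := fun x =>
    (Submodule.Quotient.mk_eq_zero _).trans Iff.rfl
  -- One direction makes `r` factor through `q`, defining the connecting map; the other, where the
  -- vanishing of `H^p(C)` enters, makes it injective.
  have hker : ∀ x : E, q x = 0 ↔ r x = 0 := by
    intro x
    rw [hr0, hq0]
    constructor
    · intro h
      obtain ⟨b, hb, hbx⟩ := exists_mem_modCoboundaries hπ hsurj h
      obtain ⟨c', hc'⟩ := (hex p (x.1.1 - b)).1 (by rw [map_sub, hbx, sub_self])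
      refine ⟨c', hginj _ _ _ ?_⟩
      rw [← map_smul, hc', map_sub, diff_eq_zero_of_mem_modCoboundaries hd hb, sub_zero, hE x]
    · rintro ⟨c', hc'⟩
      have h1 : x.1.1 - g • c' ∈ modCoboundaries d p :=
        hp _ (by rw [map_sub, map_smul, hc', hE x, sub_self])
      have h2 := map_mem_modCoboundaries hπ h1
      rwa [map_sub, hπg, sub_zero] at h2
  have hqs : Function.Surjective q := by
    intro z
    obtain ⟨⟨c, hc⟩, rfl⟩ := Submodule.mkQ_surjective _ z
    obtain ⟨a, rfl⟩ := hsurj p c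
    rw [LinearMap.mem_ker, ← hπ] at hc
    obtain ⟨b, hb⟩ := (hex (p + 1) _).1 hc
    refine ⟨⟨(a, b), ?_⟩, rfl⟩
    rw [LinearMap.mem_ker]
    exact sub_eq_zero.2 hb.symm
  let e := q.quotKerEquivOfSurjective hqs
  have he : ∀ x : E, e.symm (q x) = (LinearMap.ker q).mkQ x := fun x =>
    e.symm_apply_eq.2 rfl
  let δ : ModCohomology d' p →ₗ[R] ModCohomology d (p + 1) :=
    (LinearMap.ker q).liftQ r (fun x hx => (hker x).1 hx) ∘ₗ e.symm.toLinearMap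
  have hδ : ∀ x : E, δ (q x) = r x := fun x => by
    change (LinearMap.ker q).liftQ r (fun x hx => (hker x).1 hx) (e.symm (q x)) = _
    rw [he]
    exact Submodule.liftQ_apply _ _ _
  refine ⟨δ, ?_, fun z => ⟨?_, fun hz => ?_⟩⟩
  · rw [← LinearMap.ker_eq_bot, LinearMap.ker_eq_bot']
    intro z hz
    obtain ⟨x, rfl⟩ := hqs z
    rw [hδ] at hz
    exact (hker x).2 hz
  · rintro ⟨y, rfl⟩
    obtain ⟨x, rfl⟩ := hqs y
    rw [hδ, ← map_smul]
    exact (hr0 _).2 ⟨x.1.1, hE x⟩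
  · obtain ⟨⟨b, hb⟩, rfl⟩ := Submodule.mkQ_surjective _ z
    obtain ⟨c, hc⟩ := (Submodule.Quotient.mk_eq_zero _).1 hz
    refine ⟨q ⟨(c, b), ?_⟩, ?_⟩
    · rw [LinearMap.mem_ker]
      exact sub_eq_zero.2 hc
    · rw [hδ]
      rfl

end ModuleCohomology

/-! ### Čech cohomology of modules -/

section CechCohomology

variable {R : Type*} [CommRing R] {s : ℕ} (f : Fin s → R)
  {M : Type*} [AddCommGroup M] [Module R M] {A : Finset (Fin s) → Type*}
  [∀ S, AddCommGroup (A S)] [∀ S, Module R (A S)] (ι : ∀ S, M →ₗ[R] A S)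
  [hι : ∀ S, IsLocalizedModule (prodPowers f S) (ι S)]

/-- Extension by zero of `p`-cochains, as a linear map. -/
def extendZeroLin (R : Type*) [CommRing R] {s : ℕ} (A : Finset (Fin s) → Type*)
    [∀ S, AddCommGroup (A S)] [∀ S, Module R (A S)] (p : ℕ) :
    (∀ S : Subsets s p, A S.1) →ₗ[R] (∀ S, A S) where
  toFun := extendZero
  map_add' c c' := by
    funext S
    by_cases h : S.card = p <;> simp [extendZero, h]
  map_smul' r c := by
    funext S
    by_cases h : S.card = p <;> simp [extendZero, h]

/-- The differential of the Čech complex of a module. -/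
def modCechDiff (p : ℕ) : (∀ S : Subsets s p, A S.1) →ₗ[R] (∀ T : Subsets s (p + 1), A T.1) :=
  (LinearMap.pi fun T => LinearMap.proj T.1) ∘ₗ totalDiff f ι ∘ₗ extendZeroLin R A p

theorem modCechDiff_apply {p : ℕ} (c : ∀ S : Subsets s p, A S.1) (T : Subsets s (p + 1)) :
    modCechDiff f ι p c T = totalDiff f ι (extendZero c) T.1 := rfl

theorem modCechDiff_restrict {p : ℕ} (c : ∀ S, A S) (T : Subsets s (p + 1)) :
    modCechDiff f ι p (fun S => c S.1) T = totalDiff f ι c T.1 := by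
  rw [modCechDiff_apply]
  exact totalDiff_congr f ι fun i hi => extendZero_apply (fun S : Subsets s p => c S.1)
    (T.erase ⟨i, hi⟩)

theorem modCechDiff_modCechDiff (p : ℕ) (c : ∀ S : Subsets s p, A S.1) :
    modCechDiff f ι (p + 1) (modCechDiff f ι p c) = 0 := by
  funext T
  exact (modCechDiff_restrict f ι (totalDiff f ι (extendZero c)) T).trans
    (totalDiff_totalDiff f ι _ _)

/-- Čech cohomology of a module. -/
abbrev ModCech (p : ℕ) : Type _ :=
  ModCohomology (C := fun p => ∀ S : Subsets s p, A S.1) (modCechDiff f ι) p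

theorem modCech_torsion {p : ℕ} (i : Fin s) (z : ModCech f ι p) : ∃ k : ℕ, f i ^ k • z = 0 := by
  obtain ⟨⟨c, hc⟩, rfl⟩ := Submodule.mkQ_surjective _ z
  obtain ⟨k, b, hb⟩ := exists_smul_eq_totalDiff f ι (p := p) i (c := extendZero c) (fun T hT =>
    congrFun (LinearMap.mem_ker.1 hc) ⟨T, hT⟩)
  refine ⟨k, ?_⟩
  rw [← map_smul]
  refine (Submodule.Quotient.mk_eq_zero _).2 ?_
  have hb' : ∀ S : Subsets s p, f i ^ k • c S = totalDiff f ι b S.1 := fun S => by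
    rw [← hb S.1 S.2, extendZero_apply]
  cases p with
  | zero =>
    change f i ^ k • c = 0
    funext S
    rw [Pi.smul_apply, hb', totalDiff_apply]
    have : IsEmpty {i // i ∈ S.1} := ⟨fun j => Finset.notMem_empty j.1
      (Finset.card_eq_zero.1 S.2 ▸ j.2)⟩
    simp
  | succ p =>
    refine ⟨fun S => b S.1, funext fun S => ?_⟩
    rw [modCechDiff_restrict]
    exact (hb' S).symm

/-- The radical of the annihilator of `z` is an ideal containing every `f i`. -/
theorem modCech_radical_torsion {p : ℕ} {g : R} (hg : g ∈ (Ideal.span (Set.range f)).radical)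
    (z : ModCech f ι p) : ∃ k : ℕ, g ^ k • z = 0 := by
  have h1 : Ideal.span (Set.range f) ≤ (Ideal.torsionOf R _ z).radical := by
    rw [Ideal.span_le]
    rintro _ ⟨i, rfl⟩
    exact modCech_torsion f ι i z
  exact Ideal.radical_le_radical_iff.2 h1 hg

/-- The submodule of sections supported on the zero set of the `f_i`. -/
def torsionSections (M : Type*) [AddCommGroup M] [Module R M] : Submodule R M where
  carrier := {m | ∀ i, ∃ k : ℕ, f i ^ k • m = 0}
  zero_mem' i := ⟨0, by simp⟩
  add_mem' {a b} ha hb i := by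
    obtain ⟨k, hk⟩ := ha i
    obtain ⟨l, hl⟩ := hb i
    refine ⟨k + l, ?_⟩
    rw [smul_add, pow_add, mul_smul, mul_smul, hl, smul_comm, hk]
    simp
  smul_mem' r a ha i := by
    obtain ⟨k, hk⟩ := ha i
    exact ⟨k, by rw [smul_comm, hk, smul_zero]⟩

theorem mem_torsionSections {m : M} :
    m ∈ torsionSections f M ↔ ∀ i, ∃ k : ℕ, f i ^ k • m = 0 := Iff.rfl

/-- Čech cohomology in degree zero. -/
theorem exists_torsionSections_equiv :
    ∃ Δ : torsionSections f M →ₗ[R] ModCech f ι 0, Function.Bijective Δ := by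
  -- The empty product is `1`, so the degree-zero term is `M` itself.
  have hι0 : Function.Bijective (ι ∅) := by
    constructor
    · rw [← LinearMap.ker_eq_bot, LinearMap.ker_eq_bot']
      intro m hm
      obtain ⟨k, hk⟩ := (loc_eq_zero_iff f ι).1 hm
      simpa using hk
    · intro x
      obtain ⟨k, m, hm⟩ := exists_smul_eq_loc f ι x
      exact ⟨m, by simpa using hm.symm⟩
  have h1 : ∀ m : M, totalDiff f ι (fun S => ι S m) = fun T =>
      ∑ i : {i // i ∈ T}, ((-1 : ℤ) ^ (T.filter (· < i.1)).card) • ι T m := fun m => by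
    funext T
    simp [totalDiff_apply]
  have hker : ∀ m : M, modCechDiff f ι 0 (fun S => ι S.1 m) = 0 ↔ m ∈ torsionSections f M := by
    intro m
    have h2 : ∀ i : Fin s, ι {i} m = 0 ↔ ∃ k : ℕ, f i ^ k • m = 0 := fun i => by
      rw [loc_eq_zero_iff f ι, Finset.prod_singleton]
    rw [mem_torsionSections, funext_iff]
    constructor
    · intro h i
      have h3 := h ⟨{i}, Finset.card_singleton i⟩
      rw [modCechDiff_restrict f ι (fun S => ι S m), h1] at h3
      rw [← h2 i]
      beta_reduce at h3
      rw [Finset.sum_coe_sort {i} (fun j => ((-1 : ℤ) ^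
        (({i} : Finset (Fin s)).filter (· < j)).card) • ι {i} m), Finset.sum_singleton] at h3
      simpa [Finset.filter_singleton] using h3
    · rintro h ⟨T, hT⟩
      obtain ⟨i, rfl⟩ := Finset.card_eq_one.1 hT
      rw [modCechDiff_restrict f ι (fun S => ι S m), h1]
      simp [(h2 i).2 (h i)]
  let Δ : torsionSections f M →ₗ[R] ModCech f ι 0 := Submodule.mkQ _ ∘ₗ
    ((LinearMap.pi fun S : Subsets s 0 => ι S.1) ∘ₗ Submodule.subtype _).codRestrict
      (LinearMap.ker (modCechDiff f ι 0)) (fun m => LinearMap.mem_ker.2 ((hker m.1).2 m.2))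
  refine ⟨Δ, ?_, ?_⟩
  · rw [← LinearMap.ker_eq_bot, LinearMap.ker_eq_bot']
    intro m hm
    have h3 : (fun S : Subsets s 0 => ι S.1 m.1) = 0 := (Submodule.Quotient.mk_eq_zero _).1 hm
    have h4 : ι ∅ m.1 = 0 := congrFun h3 ⟨∅, rfl⟩
    exact Subtype.ext (hι0.1 (h4.trans (map_zero _).symm))
  · intro z
    obtain ⟨⟨c, hc⟩, rfl⟩ := Submodule.mkQ_surjective _ z
    obtain ⟨m, hm⟩ := hι0.2 (c ⟨∅, rfl⟩)
    have hcm : c = fun S : Subsets s 0 => ι S.1 m := by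
      funext ⟨S, hS⟩
      obtain rfl := Finset.card_eq_zero.1 hS
      exact hm.symm
    subst hcm
    exact ⟨⟨m, (hker m).1 (LinearMap.mem_ker.1 hc)⟩, rfl⟩

variable {M' : Type*} [AddCommGroup M'] [Module R M'] {A' : Finset (Fin s) → Type*}
  [∀ S, AddCommGroup (A' S)] [∀ S, Module R (A' S)] (ι' : ∀ S, M' →ₗ[R] A' S)
  [hι' : ∀ S, IsLocalizedModule (prodPowers f S) (ι' S)]

/-- The map of localizations induced by a linear map. -/
def locMap (φ : M →ₗ[R] M') (S : Finset (Fin s)) : A S →ₗ[R] A' S :=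
  IsLocalizedModule.map (prodPowers f S) (ι S) (ι' S) φ

theorem locMap_locRes (φ : M →ₗ[R] M') {S T : Finset (Fin s)} (h : S ⊆ T) (x : A S) :
    locMap f ι ι' φ T (locRes f ι h x) = locRes f ι' h (locMap f ι ι' φ S x) := by
  have : locMap f ι ι' φ T ∘ₗ locRes f ι h = locRes f ι' h ∘ₗ locMap f ι ι' φ S := by
    refine IsLocalizedModule.ext (prodPowers f S) (ι S) (isUnit_prodPowers f ι' h) ?_
    ext m
    simp [locMap]
  exact LinearMap.congr_fun this x

/-- Localization is exact, so `0 → M → M → M' → 0`, with first map `g`, induces a short exact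
sequence of Čech complexes, to which `exists_connecting` applies. -/
theorem exists_modCech_connecting {g : R} {φ : M →ₗ[R] M'} (hφ : Function.Surjective φ)
    (hg : ∀ m : M, g • m = 0 → m = 0) (hex : ∀ m, φ m = 0 ↔ ∃ m', g • m' = m) {p : ℕ}
    (hp : Subsingleton (ModCech f ι p)) :
    ∃ δ : ModCech f ι' p →ₗ[R] ModCech f ι (p + 1), Function.Injective δ ∧
      ∀ z, z ∈ LinearMap.range δ ↔ g • z = 0 := by
  have hgmap : ∀ S, IsLocalizedModule.map (prodPowers f S) (ι S) (ι S) (LinearMap.lsmul R M g) =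
      LinearMap.lsmul R (A S) g := fun S => by
    refine IsLocalizedModule.linearMap_ext (prodPowers f S) (ι S) (ι S) ?_
    ext m
    simp
  have hgA : ∀ S (x : A S), g • x = 0 → x = 0 := fun S x hx => by
    have h1 := IsLocalizedModule.map_injective (prodPowers f S) (ι S) (ι S)
      (LinearMap.lsmul R M g) (fun a b hab => sub_eq_zero.1 (hg _ (by
        rw [smul_sub, sub_eq_zero]; exact hab)))
    rw [hgmap] at h1
    exact h1 (by simpa using hx)
  have hexA : ∀ S (x : A S), locMap f ι ι' φ S x = 0 ↔ ∃ y, g • y = x := fun S x => by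
    have h1 := IsLocalizedModule.map_exact (prodPowers f S) (ι S) (ι S) (ι' S)
      (LinearMap.lsmul R M g) φ (fun m => (hex m).trans Iff.rfl)
    rw [hgmap] at h1
    exact h1 x
  refine exists_connecting (modCechDiff_modCechDiff f ι)
    (π := fun p => LinearMap.pi fun S : Subsets s p => locMap f ι ι' φ S.1 ∘ₗ LinearMap.proj S)
    ?_ ?_ g ?_ ?_ hp
  · intro p c
    funext T
    change locMap f ι ι' φ T.1 (totalDiff f ι (extendZero c) T.1) = totalDiff f ι' _ T.1
    rw [totalDiff_apply, totalDiff_apply, map_sum]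
    refine Finset.sum_congr rfl fun i _ => ?_
    rw [map_zsmul, locMap_locRes]
    congr 2
    rw [extendZero_apply c (T.erase i)]
    exact (extendZero_apply (fun S : Subsets s p => locMap f ι ι' φ S.1 (c S)) (T.erase i)).symm
  · intro p c
    choose b hb using fun S : Subsets s p =>
      IsLocalizedModule.map_surjective (prodPowers f S.1) (ι S.1) (ι' S.1) φ hφ (c S)
    exact ⟨b, funext hb⟩
  · exact fun p c hc => funext fun S => hgA S.1 _ (congrFun hc S)
  · intro p c
    constructor
    · intro h
      choose b hb using fun S : Subsets s p => (hexA S.1 (c S)).1 (congrFun h S)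
      exact ⟨b, funext hb⟩
    · rintro ⟨b, rfl⟩
      exact funext fun S => (hexA S.1 _).2 ⟨b S, rfl⟩

end CechCohomology

/-! ### Čech cohomology along a regular sequence -/

section Depth

variable {R : Type u} [CommRing R] {s : ℕ} (f : Fin s → R)

/-- Let `M_0 → M_1 → ⋯ → M_n` be successive quotients by elements `g_0, …, g_{n-1}` of the radical
of `(f_1, …, f_s)` with `g_k` regular on `M_k`. Then the Čech cohomology of `M_0` vanishes below
degree `n`, and the common kernel of the `g_k` in degree `n` consists of the sections of `M_n`
supported on the zero set of the `f_i`. -/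
theorem modCech_of_regular (n : ℕ) (g : ℕ → R)
    (hgf : ∀ k < n, g k ∈ (Ideal.span (Set.range f)).radical)
    (M : ℕ → Type u) [∀ k, AddCommGroup (M k)] [∀ k, Module R (M k)]
    (φ : ∀ k, M k →ₗ[R] M (k + 1)) (hφ : ∀ k < n, Function.Surjective (φ k))
    (hg : ∀ k < n, ∀ m : M k, g k • m = 0 → m = 0)
    (hex : ∀ k < n, ∀ m, φ k m = 0 ↔ ∃ m', g k • m' = m)
    {A : Finset (Fin s) → Type u} [∀ S, AddCommGroup (A S)] [∀ S, Module R (A S)]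
    (ι : ∀ S, M 0 →ₗ[R] A S) [∀ S, IsLocalizedModule (prodPowers f S) (ι S)] :
    (∀ p < n, Subsingleton (ModCech f ι p)) ∧
    ∃ Δ : torsionSections f (M n) →ₗ[R] ModCech f ι n, Function.Injective Δ ∧
      ∀ z, z ∈ LinearMap.range Δ ↔ ∀ k < n, g k • z = 0 := by
  induction n generalizing g M A with
  | zero =>
    refine ⟨fun p hp => (Nat.not_lt_zero p hp).elim, ?_⟩
    obtain ⟨Δ, hΔ⟩ := exists_torsionSections_equiv f ι
    exact ⟨Δ, hΔ.1, fun z => by simp [LinearMap.range_eq_top.2 hΔ.2]⟩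
  | succ n ih =>
    let ι' : ∀ S, M 1 →ₗ[R] LocalizedModule (prodPowers f S) (M 1) := fun S =>
      LocalizedModule.mkLinearMap _ _
    have hι' : ∀ S, IsLocalizedModule (prodPowers f S) (ι' S) := fun S =>
      localizedModuleIsLocalizedModule _
    obtain ⟨hvan, Δ, hΔ, hΔr⟩ := ih (fun k => g (k + 1)) (fun k hk => hgf _ (by omega))
      (fun k => M (k + 1)) (fun k => φ (k + 1)) (fun k hk => hφ _ (by omega))
      (fun k hk => hg _ (by omega)) (fun k hk => hex _ (by omega)) ι'
    have hconn := fun {p : ℕ} (hp : Subsingleton (ModCech f ι p)) =>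
      exists_modCech_connecting f ι ι' (hφ 0 n.succ_pos) (hg 0 n.succ_pos) (hex 0 n.succ_pos) hp
    -- Every class is killed by a power of `g 0`, so vanishing only requires that `g 0` act
    -- injectively. In degree zero this is regularity of `g 0` on `M 0`; in degree `p + 1` the
    -- kernel of `g 0` is `H^p(M 1)`, zero by induction.
    have hinj : ∀ p, (∀ z : ModCech f ι p, g 0 • z = 0 → z = 0) → Subsingleton (ModCech f ι p) := by
      intro p h
      refine subsingleton_of_forall_eq 0 fun z => ?_
      obtain ⟨k, hk⟩ := modCech_radical_torsion f ι (hgf 0 n.succ_pos) z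
      induction k with
      | zero => simpa using hk
      | succ k ihk => exact ihk (h _ (by rw [smul_smul, ← pow_succ', hk]))
    have hvan' : ∀ p < n + 1, Subsingleton (ModCech f ι p) := by
      intro p hp
      induction p with
      | zero =>
        refine hinj 0 fun z hz => ?_
        obtain ⟨Δ₀, hΔ₀⟩ := exists_torsionSections_equiv f ι
        obtain ⟨m, rfl⟩ := hΔ₀.2 z
        rw [← map_smul] at hz
        have h1 := hΔ₀.1 (hz.trans (map_zero _).symm)
        rw [show m = 0 from Subtype.ext (hg 0 n.succ_pos _ (congrArg Subtype.val h1)), map_zero]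
      | succ p ihp =>
        have h0 := ihp (by omega)
        obtain ⟨δ, hδ, hδr⟩ := hconn h0
        have h1 := hvan p (by omega)
        refine hinj _ fun z hz => ?_
        obtain ⟨y, rfl⟩ := (hδr z).2 hz
        rw [Subsingleton.elim y 0, map_zero]
    refine ⟨hvan', ?_⟩
    obtain ⟨δ, hδ, hδr⟩ := hconn (hvan' n n.lt_succ_self)
    refine ⟨δ ∘ₗ Δ, hδ.comp hΔ, fun z => ⟨?_, fun hz => ?_⟩⟩
    · rintro ⟨y, rfl⟩ k hk
      cases k with
      | zero => exact (hδr _).1 ⟨_, rfl⟩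
      | succ k =>
        rw [LinearMap.comp_apply, ← map_smul, (hΔr _).1 ⟨y, rfl⟩ k (by omega), map_zero]
    · obtain ⟨y, rfl⟩ := (hδr z).2 (hz 0 n.succ_pos)
      -- The remaining `g (k + 1)` kill `y` because `δ` is linear over `R` and injective.
      obtain ⟨w, rfl⟩ := (hΔr y).2 fun k hk => hδ (by
        rw [map_smul, map_zero]
        exact hz (k + 1) (by omega))
      exact ⟨w, rfl⟩

end Depth

/-! ### The action of differential operators on local cohomology -/

section LocalCohomologyOperators

variable {K R : Type u} [Field K] [CommRing R] [Algebra K R] {s : ℕ} (f : Fin s → R)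

/-- The localization maps `R → R_{f_S}`. -/
abbrev cechMap (S : Finset (Fin s)) : R →ₗ[R] CechPiece f S := Algebra.linearMap R (CechPiece f S)

theorem awayMap_eq_locRes {S T : Finset (Fin s)} (h : S ⊆ T) (hd : ∏ i ∈ S, f i ∣ ∏ i ∈ T, f i)
    (x : CechPiece f S) : awayMap (K := K) hd x = locRes f (cechMap f) h x := by
  have hlin : ∀ (r : R) (x : CechPiece f S),
      awayMap (K := K) hd (r • x) = r • awayMap (K := K) hd x := fun r x => by
    rw [Algebra.smul_def, map_mul, awayMap_algebraMap, ← Algebra.smul_def]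
  have := locRes_unique f (cechMap f) h
    { toFun := awayMap (K := K) hd, map_add' := map_add _, map_smul' := hlin }
    (fun m => awayMap_algebraMap hd m)
  rw [this]
  rfl

theorem cechDiff_eq_modCechDiff (p : ℕ) (c : ∀ S : Subsets s p, CechPiece f S.1) :
    cechDiff K f p c = modCechDiff f (cechMap f) p c := by
  funext T
  rw [modCechDiff_apply, totalDiff_apply]
  refine Finset.sum_congr rfl fun i _ => ?_
  rw [sgn_smul]
  congr 1
  refine (awayMap_eq_locRes f (T.1.erase_subset i.1) (prod_erase_dvd f T.1 i.1)
    (c (T.erase i))).trans ?_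
  rw [extendZero_apply c (T.erase i)]

theorem mem_coboundaries_cechDiff {p : ℕ} (c : ∀ S : Subsets s p, CechPiece f S.1) :
    c ∈ coboundaries (C := fun p => ∀ S : Subsets s p, CechPiece f S.1) (cechDiff K f) p ↔
      c ∈ modCoboundaries (C := fun p => ∀ S : Subsets s p, CechPiece f S.1)
        (modCechDiff f (cechMap f)) p := by
  cases p with
  | zero => exact Iff.rfl
  | succ p =>
    constructor
    · rintro ⟨b, rfl⟩
      exact ⟨b, (cechDiff_eq_modCechDiff f p b).symm⟩
    · rintro ⟨b, rfl⟩
      exact ⟨b, cechDiff_eq_modCechDiff f p b⟩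

/-- The identification of local cohomology over `K` with the Čech cohomology of the
`R`-module `R`. -/
def lcToModCech (K : Type u) [Field K] [Algebra K R] (f : Fin s → R) (p : ℕ) :
    LocalCohomology K f p →ₗ[K] ModCech f (cechMap f) p :=
  Submodule.liftQ _
    ((Submodule.mkQ ((modCoboundaries (modCechDiff f (cechMap f)) p).submoduleOf
        (LinearMap.ker (modCechDiff f (cechMap f) p)))).restrictScalars K ∘ₗ
      (LinearMap.codRestrict ((LinearMap.ker (modCechDiff f (cechMap f) p)).restrictScalars K)
        (Submodule.subtype (LinearMap.ker (cechDiff K f p)))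
        (fun c => LinearMap.mem_ker.2 ((cechDiff_eq_modCechDiff f p c.1).symm.trans c.2))))
    (fun c hc => (Submodule.Quotient.mk_eq_zero _).2
      ((mem_coboundaries_cechDiff f c.1).1 hc))

theorem lcToModCech_bijective (p : ℕ) : Function.Bijective (lcToModCech K f p) := by
  constructor
  · rw [← LinearMap.ker_eq_bot, LinearMap.ker_eq_bot']
    intro z hz
    obtain ⟨c, rfl⟩ := Submodule.mkQ_surjective _ z
    have hz' : c.1 ∈ modCoboundaries (C := fun p => ∀ S : Subsets s p, CechPiece f S.1)
        (modCechDiff f (cechMap f)) p :=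
      (Submodule.Quotient.mk_eq_zero ((modCoboundaries (modCechDiff f (cechMap f)) p).submoduleOf
        (LinearMap.ker (modCechDiff f (cechMap f) p)))).1 hz
    exact (Submodule.Quotient.mk_eq_zero _).2 ((mem_coboundaries_cechDiff f c.1).2 hz')
  · intro z
    obtain ⟨⟨c, hc⟩, rfl⟩ := Submodule.mkQ_surjective _ z
    exact ⟨Submodule.mkQ _ ⟨c, LinearMap.mem_ker.2
      ((cechDiff_eq_modCechDiff f p c).trans (LinearMap.mem_ker.1 hc))⟩, rfl⟩

/-- Local cohomology over `K` is the Čech cohomology of the `R`-module `R`. -/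
def lcEquiv (K : Type u) [Field K] [Algebra K R] (f : Fin s → R) (p : ℕ) :
    LocalCohomology K f p ≃ₗ[K] ModCech f (cechMap f) p :=
  LinearEquiv.ofBijective (lcToModCech K f p) (lcToModCech_bijective f p)

/-- The action of `R` on local cohomology. -/
def lcMul (K : Type u) [Field K] [Algebra K R] (f : Fin s → R) (p : ℕ) :
    R →ₐ[K] Module.End K (LocalCohomology K f p) :=
  ((lcEquiv K f p).symm.conjAlgEquiv K).toAlgHom.comp (Algebra.lsmul K K _)

theorem lcEquiv_lcMul (p : ℕ) (r : R) (z : LocalCohomology K f p) :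
    lcEquiv K f p (lcMul K f p r z) = r • lcEquiv K f p z := by
  simp [lcMul]

theorem smul_mem_ker_cechDiff {p : ℕ} (r : R) {c : ∀ S : Subsets s p, CechPiece f S.1}
    (hc : c ∈ LinearMap.ker (cechDiff K f p)) : r • c ∈ LinearMap.ker (cechDiff K f p) := by
  rw [LinearMap.mem_ker, cechDiff_eq_modCechDiff] at hc ⊢
  rw [map_smul, hc, smul_zero]

theorem lcMul_mk (p : ℕ) (r : R) (c : ∀ S : Subsets s p, CechPiece f S.1)
    (hc : c ∈ LinearMap.ker (cechDiff K f p)) :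
    lcMul K f p r (Submodule.Quotient.mk ⟨c, hc⟩) =
      Submodule.Quotient.mk ⟨r • c, smul_mem_ker_cechDiff f r hc⟩ := by
  apply (lcEquiv K f p).injective
  rw [lcEquiv_lcMul]
  rfl

theorem awayDerivation_smul (D : Derivation K R R) (g r : R) (x : Localization.Away g) :
    awayDerivation D g (r • x) = r • awayDerivation D g x + D r • x := by
  rw [Algebra.smul_def, Derivation.leibniz, awayDerivation_algebraMap, smul_eq_mul,
    smul_eq_mul, mul_comm x, ← Algebra.smul_def, ← Algebra.smul_def]

/-- The commutator of the two extensions is a derivation vanishing on the image of `R`, hence on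
every fraction. -/
theorem awayDerivation_comm {D D' : Derivation K R R} (h : ∀ r, D (D' r) = D' (D r)) (g : R)
    (x : Localization.Away g) :
    awayDerivation D g (awayDerivation D' g x) = awayDerivation D' g (awayDerivation D g x) := by
  obtain ⟨⟨a, m⟩, hx⟩ := IsLocalization.surj (Submonoid.powers g) x
  simp only at hx
  let B : Derivation K (Localization.Away g) (Localization.Away g) :=
    ⁅awayDerivation D g, awayDerivation D' g⁆
  have hB : ∀ y, B y = awayDerivation D g (awayDerivation D' g y) -
      awayDerivation D' g (awayDerivation D g y) := fun y =>
    Derivation.commutator_apply y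
  have h1 : ∀ b : R, B (algebraMap R (Localization.Away g) b) = 0 := fun b => by
    rw [hB]
    simp only [awayDerivation_algebraMap, h, sub_self]
  have h2 := congrArg B hx
  rw [h1, Derivation.leibniz, h1, smul_zero, zero_add, smul_eq_mul,
    (IsLocalization.map_units (Localization.Away g) m).mul_right_eq_zero,
    hB, sub_eq_zero] at h2
  exact h2

theorem lcDerivation_mk (D : Derivation K R R) (p : ℕ) (c : ∀ S : Subsets s p, CechPiece f S.1)
    (hc : c ∈ LinearMap.ker (cechDiff K f p)) :
    ∃ hc', lcDerivation D f p (Submodule.Quotient.mk ⟨c, hc⟩) =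
      Submodule.Quotient.mk ⟨cechDerivation D f p c, hc'⟩ :=
  ⟨_, rfl⟩

/-- Leibniz's rule on cochains passes to cohomology; with partial derivatives and variables it
yields the Weyl algebra relations. -/
theorem lcDerivation_lcMul (D : Derivation K R R) (p : ℕ) (r : R) (z : LocalCohomology K f p) :
    lcDerivation D f p (lcMul K f p r z) =
      lcMul K f p r (lcDerivation D f p z) + lcMul K f p (D r) z := by
  obtain ⟨⟨c, hc⟩, rfl⟩ := Submodule.Quotient.mk_surjective _ z
  obtain ⟨hc', h1⟩ := lcDerivation_mk f D p c hc
  obtain ⟨hc'', h2⟩ := lcDerivation_mk f D p (r • c) (smul_mem_ker_cechDiff f r hc)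
  rw [lcMul_mk, lcMul_mk, h1, h2, lcMul_mk, ← Submodule.Quotient.mk_add]
  congr 1
  exact Subtype.ext (funext fun S => awayDerivation_smul D _ r (c S))

theorem lcDerivation_comm {D D' : Derivation K R R} (h : ∀ r, D (D' r) = D' (D r)) (p : ℕ)
    (z : LocalCohomology K f p) :
    lcDerivation D f p (lcDerivation D' f p z) = lcDerivation D' f p (lcDerivation D f p z) := by
  obtain ⟨⟨c, hc⟩, rfl⟩ := Submodule.Quotient.mk_surjective _ z
  obtain ⟨h1', h1⟩ := lcDerivation_mk f D p c hc
  obtain ⟨h2', h2⟩ := lcDerivation_mk f D' p c hc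
  obtain ⟨h3', h3⟩ := lcDerivation_mk f D' p _ h1'
  obtain ⟨h4', h4⟩ := lcDerivation_mk f D p _ h2'
  rw [h1, h2, h3, h4]
  congr 1
  exact Subtype.ext (funext fun S => awayDerivation_comm h _ (c S))

end LocalCohomologyOperators

/-! ### Zero-dimensional ideals of polynomial rings -/

section ZeroDimensional

open MvPolynomial

variable {K : Type u} [Field K] {n : ℕ}

/-- Finite length makes the quotient an Artinian ring, and an Artinian algebra of finite type over a
field is finite-dimensional. -/
theorem finite_quotient_of_isZeroDimensional {I : Ideal (MvPolynomial (Fin n) K)}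
    (hI : IsZeroDimensional I) : Module.Finite K (MvPolynomial (Fin n) K ⧸ I) := by
  have h1 := (isFiniteLength_iff_isNoetherian_isArtinian.1 (Module.length_ne_top_iff.1 hI.1)).2
  have h2 : IsArtinianRing (MvPolynomial (Fin n) K ⧸ I) :=
    isArtinian_of_tower (MvPolynomial (Fin n) K) h1
  exact (Module.finite_iff_isArtinianRing K _).2 h2

/-- Each variable satisfies a separable equation modulo the radical of a zero-dimensional ideal. -/
theorem exists_separable_aeval_mem_radical [CharZero K] {I : Ideal (MvPolynomial (Fin n) K)}
    (hI : IsZeroDimensional I) (i : Fin n) :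
    ∃ g : Polynomial K, g.Monic ∧ g.Separable ∧
      Polynomial.aeval (X i : MvPolynomial (Fin n) K) g ∈ I.radical := by
  have := finite_quotient_of_isZeroDimensional hI
  have hfin : Module.Finite K (MvPolynomial (Fin n) K ⧸ I.radical) :=
    Module.Finite.of_surjective (Ideal.Quotient.factorₐ K I.le_radical).toLinearMap
      (Ideal.Quotient.factor_surjective I.le_radical)
  have hred : IsReduced (MvPolynomial (Fin n) K ⧸ I.radical) :=
    (Ideal.isRadical_iff_quotient_reduced _).1 I.radical_isRadical
  let x : MvPolynomial (Fin n) K ⧸ I.radical := Ideal.Quotient.mkₐ K _ (X i)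
  have hint : IsIntegral K x := Algebra.IsIntegral.isIntegral x
  refine ⟨minpoly K x, minpoly.monic hint, ?_, ?_⟩
  -- If `q²` divided the minimal polynomial `q² r`, then `q r` would square to zero at `x`, hence
  -- vanish at `x` by reducedness; minimality forces `q` to be a unit.
  · rw [PerfectField.separable_iff_squarefree]
    rintro q ⟨r, hr⟩
    have h0 : q * r ≠ 0 := by
      intro h
      apply minpoly.ne_zero hint
      rw [hr, mul_assoc, h, mul_zero]
    have h1 : Polynomial.aeval x (q * r) = 0 := by
      refine pow_eq_zero_iff (two_ne_zero) |>.1 ?_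
      rw [← map_pow, show (q * r) ^ 2 = q * q * r * r by ring, ← hr, map_mul, minpoly.aeval,
        zero_mul]
    have h2 := minpoly.dvd K x h1
    rw [hr, mul_assoc] at h2
    exact isUnit_of_dvd_one ((mul_dvd_mul_iff_right h0).1 (by rwa [one_mul]))
  · rw [← Ideal.Quotient.eq_zero_iff_mem, ← Ideal.Quotient.mkₐ_eq_mk K,
      ← Polynomial.aeval_algHom_apply]
    exact minpoly.aeval K x

/-- Polynomials in distinct variables form a regular sequence. -/
theorem mem_span_of_aeval_mul_mem (g : Fin n → Polynomial K) {k : Fin n} (hk : (g k).Monic)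
    {U : Set (Fin n)} (hU : k ∉ U) {u : MvPolynomial (Fin n) K}
    (hu : Polynomial.aeval (X k) (g k) * u ∈
      Ideal.span ((fun j => Polynomial.aeval (X j : MvPolynomial (Fin n) K) (g j)) '' U)) :
    u ∈ Ideal.span ((fun j => Polynomial.aeval (X j : MvPolynomial (Fin n) K) (g j)) '' U) := by
  set J := Ideal.span ((fun j => Polynomial.aeval (X j : MvPolynomial (Fin n) K) (g j)) '' U)
  let B := MvPolynomial (Fin n) K ⧸ J
  let π : MvPolynomial (Fin n) K →ₐ[K] B := Ideal.Quotient.mkₐ K J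
  -- `ψ` keeps `X k` as a free variable and reduces the others modulo `J`. It kills `J`, whose
  -- generators do not involve `X k`, and sends the `k`-th polynomial to a monic one, a
  -- non-zero-divisor. Evaluating at the class of `X k` recovers `π`.
  let y : Fin n → Polynomial B := fun j =>
    if j = k then Polynomial.X else Polynomial.CAlgHom (R := K) (π (X j))
  let ψ : MvPolynomial (Fin n) K →ₐ[K] Polynomial B := aeval y
  have hψJ : ∀ v ∈ J, ψ v = 0 := by
    intro v hv
    have : J ≤ RingHom.ker ψ := by
      refine Ideal.span_le.2 ?_
      rintro _ ⟨j, hj, rfl⟩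
      have hjk : j ≠ k := fun h => hU (h ▸ hj)
      rw [SetLike.mem_coe, RingHom.mem_ker]
      simp only
      rw [← Polynomial.aeval_algHom_apply, show ψ (X j) = Polynomial.CAlgHom (R := K) (π (X j)) by
        simp [ψ, y, hjk], Polynomial.aeval_algHom_apply, Polynomial.aeval_algHom_apply]
      have h1 : π (Polynomial.aeval (X j) (g j)) = 0 :=
        Ideal.Quotient.eq_zero_iff_mem.2 (Ideal.subset_span ⟨j, hj, rfl⟩)
      rw [h1, map_zero]
    exact this hv
  have hψk : ψ (Polynomial.aeval (X k) (g k)) = (g k).map (algebraMap K B) := by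
    rw [← Polynomial.aeval_algHom_apply, show ψ (X k) = Polynomial.X by simp [ψ, y],
      Polynomial.aeval_X_left_eq_map]
  have hu0 : ψ u = 0 := by
    have h1 := hψJ _ hu
    rw [map_mul, hψk] at h1
    exact (hk.map (algebraMap K B)).mul_right_eq_zero_iff.1 h1
  have hev : ((Polynomial.aeval (π (X k))).restrictScalars K : Polynomial B →ₐ[K] B).comp ψ = π := by
    ext j
    by_cases hj : j = k
    · subst hj
      simp [ψ, y]
    · simp [ψ, y, hj]
  refine Ideal.Quotient.eq_zero_iff_mem.1 (show π u = 0 from ?_)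
  rw [← hev, AlgHom.comp_apply, hu0, map_zero]

variable (g : Fin n → Polynomial K)

/-- The algebra cut out by one separable equation for each variable is unramified. -/
theorem formallyUnramified_quotient (hg : ∀ i, (g i).Separable)
    {J : Ideal (MvPolynomial (Fin n) K)} (hJ : ∀ i, Polynomial.aeval (X i) (g i) ∈ J) :
    Algebra.FormallyUnramified K (MvPolynomial (Fin n) K ⧸ J) := by
  rw [Algebra.FormallyUnramified.iff_comp_injective]
  intro B _ _ 𝔞 h𝔞 φ ψ hφψ
  refine Ideal.Quotient.algHom_ext K (MvPolynomial.algHom_ext fun i => ?_)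
  set x : MvPolynomial (Fin n) K ⧸ J := Ideal.Quotient.mkₐ K J (X i) with hx
  have hgx : Polynomial.aeval x (g i) = 0 := by
    rw [hx, Polynomial.aeval_algHom_apply]
    exact Ideal.Quotient.eq_zero_iff_mem.2 (hJ i)
  change φ x = ψ x
  have h1 : φ x - ψ x ∈ 𝔞 := Ideal.Quotient.eq.1 (AlgHom.congr_fun hφψ x)
  -- The two lifts differ by a square-zero element, so Taylor expansion of `g i` leaves `g i'(ψ x) *
  -- (φ x - ψ x) = 0`; separability makes the first factor a unit.
  have h2 : (φ x - ψ x) ^ 2 = 0 := by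
    rw [← Ideal.mem_bot, ← h𝔞]
    exact Ideal.pow_mem_pow h1 2
  have h3 := Polynomial.aeval_add_of_sq_eq_zero (g i) (ψ x) (φ x - ψ x) h2
  rw [add_sub_cancel, Polynomial.aeval_algHom_apply φ x, Polynomial.aeval_algHom_apply ψ x (g i),
    hgx, map_zero, map_zero, zero_add] at h3
  obtain ⟨a, b, hab⟩ := hg i
  have h4 := congrArg (Polynomial.aeval (ψ x)) hab
  rw [map_add, map_mul, map_mul, Polynomial.aeval_algHom_apply ψ x (g i), hgx, map_zero, mul_zero,
    zero_add, map_one] at h4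
  rw [← sub_eq_zero]
  linear_combination (-(φ x - ψ x)) * h4 - Polynomial.aeval (ψ x) b * h3

end ZeroDimensional

/-! ### Counting points of finite reduced algebras -/

section Count

/-- The number of points of a finite reduced algebra over a field of characteristic zero. -/
theorem card_algHom_eq_finrank (K : Type*) [Field K] [CharZero K] (L : Type*) [Field L]
    [Algebra K L] [IsAlgClosed L] (B : Type*) [CommRing B] [Algebra K B] [Module.Finite K B]
    [IsReduced B] :
    Finite (B →ₐ[K] L) ∧ Nat.card (B →ₐ[K] L) = Module.finrank K B := by
  have hart : IsArtinianRing B := isArtinian_of_tower K inferInstance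
  let _ : ∀ m : MaximalSpectrum B, Field (B ⧸ m.asIdeal) := fun m => Ideal.Quotient.field m.asIdeal
  -- The kernel of a homomorphism to `L` is prime, hence maximal in an Artinian ring, so
  -- homomorphisms are sorted by residue field. Reducedness makes `B` the product of its residue
  -- fields, each separable over `K`.
  let Φ : (Σ m : MaximalSpectrum B, (B ⧸ m.asIdeal) →ₐ[K] L) → (B →ₐ[K] L) := fun x =>
    x.2.comp (Ideal.Quotient.mkₐ K x.1.asIdeal)
  have hker : ∀ x, RingHom.ker (Φ x) = x.1.asIdeal := fun x => by
    ext b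
    rw [RingHom.mem_ker, ← Ideal.Quotient.eq_zero_iff_mem]
    exact map_eq_zero_iff x.2 (RingHom.injective x.2.toRingHom)
  have hΦ : Function.Bijective Φ := by
    constructor
    · rintro ⟨m, φ⟩ ⟨m', φ'⟩ h
      have hm : m = m' := by
        ext1
        rw [← hker ⟨m, φ⟩, ← hker ⟨m', φ'⟩, h]
      subst hm
      have : φ = φ' := Ideal.Quotient.algHom_ext K h
      rw [this]
    · intro φ
      have hp : (RingHom.ker φ).IsPrime := RingHom.ker_isPrime φ
      exact ⟨⟨⟨RingHom.ker φ, hp.isMaximal'⟩,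
        Ideal.Quotient.liftₐ (RingHom.ker φ) φ fun _ h => h⟩, AlgHom.ext fun b => rfl⟩
  have hfin : ∀ m : MaximalSpectrum B, Finite ((B ⧸ m.asIdeal) →ₐ[K] L) := fun m => inferInstance
  have := Fintype.ofFinite (MaximalSpectrum B)
  refine ⟨Finite.of_surjective Φ hΦ.2, ?_⟩
  rw [← Nat.card_congr (Equiv.ofBijective Φ hΦ), Nat.card_sigma,
    (((IsArtinianRing.equivPi B).restrictScalars K).toLinearEquiv).finrank_eq,
    Module.finrank_pi_fintype]
  exact Finset.sum_congr rfl fun m _ =>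
    AlgHom.natCard_of_splits K (B ⧸ m.asIdeal) L fun _ => IsAlgClosed.splits _

end Count

/-! ### Supported sections of a reduced Artinian quotient -/

section TorsionSections

/-- In a reduced Artinian quotient `R / J`, the sections supported on the zero set of an ideal form
a complement of that ideal. -/
theorem torsionSections_equiv (K : Type*) {R : Type*} [Field K] [CommRing R] [Algebra K R] {s : ℕ}
    (f : Fin s → R) (J : Ideal R) [IsReduced (R ⧸ J)] [IsArtinianRing (R ⧸ J)] :
    Nonempty (torsionSections f (R ⧸ J) ≃ₗ[K] R ⧸ (J ⊔ Ideal.span (Set.range f))) := by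
  set I := Ideal.span (Set.range f) with hI
  set 𝔞 : Ideal (R ⧸ J) := I.map (Ideal.Quotient.mkₐ K J) with h𝔞
  have := IsArtinianRing.isSemisimpleRing_of_isReduced (R ⧸ J)
  obtain ⟨𝔠, h𝔠⟩ := exists_isCompl 𝔞
  have hmem : ∀ x : R ⧸ J, x ∈ torsionSections f (R ⧸ J) ↔ x ∈ 𝔠 := by
    intro x
    rw [mem_torsionSections]
    constructor
    · intro hx
      -- By reducedness, `f i ^ k * x = 0` already implies `f i * x = 0`, so power torsion is plain
      -- annihilation by `𝔞`. The component of `x` in `𝔞` then squares to zero and vanishes.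
      have h1 : 𝔞 ≤ Ideal.torsionOf (R ⧸ J) (R ⧸ J) x := by
        rw [h𝔞, Ideal.map_le_iff_le_comap, hI, Ideal.span_le]
        rintro _ ⟨i, rfl⟩
        obtain ⟨k, hk⟩ := hx i
        change Ideal.Quotient.mk J (f i) * x = 0
        refine pow_eq_zero_iff (n := k + 1) (Nat.succ_ne_zero k) |>.1 ?_
        rw [Algebra.smul_def, map_pow] at hk
        rw [mul_pow, pow_succ, pow_succ x]
        linear_combination (Ideal.Quotient.mk J (f i) * x ^ k) * hk
      obtain ⟨a, ha, c, hc, rfl⟩ := Submodule.mem_sup.1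
        (h𝔠.sup_eq_top.ge (Submodule.mem_top (x := x)))
      have h2 : a * c = 0 := by
        rw [← Submodule.mem_bot (R ⧸ J), ← h𝔠.inf_eq_bot]
        exact ⟨𝔞.mul_mem_right c ha, 𝔠.mul_mem_left a hc⟩
      have h3 : a * (a + c) = 0 := h1 ha
      have h4 : a = 0 := pow_eq_zero_iff (n := 2) two_ne_zero |>.1 (by linear_combination h3 - h2)
      rwa [h4, zero_add]
    · intro hx i
      refine ⟨1, ?_⟩
      rw [pow_one, Algebra.smul_def, ← Submodule.mem_bot (R ⧸ J), ← h𝔠.inf_eq_bot]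
      exact ⟨𝔞.mul_mem_right x (Ideal.mem_map_of_mem _ (Ideal.subset_span ⟨i, rfl⟩)),
        𝔠.mul_mem_left _ hx⟩
  let e₁ : torsionSections f (R ⧸ J) ≃ₗ[K] 𝔠 :=
    { toFun := fun x => ⟨x.1, (hmem x.1).1 x.2⟩
      invFun := fun x => ⟨x.1, (hmem x.1).2 x.2⟩
      map_add' := fun _ _ => rfl
      map_smul' := fun _ _ => rfl
      left_inv := fun _ => rfl
      right_inv := fun _ => rfl }
  let e₂ : ((R ⧸ J) ⧸ 𝔞) ≃ₗ[K] 𝔠 :=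
    (Submodule.quotientEquivOfIsCompl 𝔞 𝔠 h𝔠).restrictScalars K
  exact ⟨e₁.trans (e₂.symm.trans (DoubleQuot.quotQuotEquivQuotSupₐ K J I).toLinearEquiv)⟩

end TorsionSections

/-! ### Zero loci as sets of algebra homomorphisms -/

section Points

open MvPolynomial

variable {K : Type*} [Field K] {n : ℕ}

/-- Points of the zero locus are homomorphisms from the coordinate ring. -/
def zeroLocusEquiv (L : Type*) [Field L] [Algebra K L] (I : Ideal (MvPolynomial (Fin n) K)) :
    zeroLocus L I ≃ ((MvPolynomial (Fin n) K ⧸ I) →ₐ[K] L) where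
  toFun a := Ideal.Quotient.liftₐ I (aeval a.1) (mem_zeroLocus_iff.1 a.2)
  invFun φ := ⟨fun i => φ (Ideal.Quotient.mkₐ K I (X i)), fun p hp => by
    have h : aeval (fun i => φ (Ideal.Quotient.mkₐ K I (X i))) =
        φ.comp (Ideal.Quotient.mkₐ K I) := MvPolynomial.algHom_ext fun i => by simp
    rw [h, AlgHom.comp_apply, Ideal.Quotient.mkₐ_eq_mk, Ideal.Quotient.eq_zero_iff_mem.2 hp,
      map_zero]⟩
  left_inv a := Subtype.ext (funext fun i =>
    (AlgHom.congr_fun (Ideal.Quotient.liftₐ_comp I _ (mem_zeroLocus_iff.1 a.2)) (X i)).trans (aeval_X _ _))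
  right_inv φ := Ideal.Quotient.algHom_ext K (MvPolynomial.algHom_ext fun i =>
    (AlgHom.congr_fun (Ideal.Quotient.liftₐ_comp I _ _) (X i)).trans (aeval_X _ _))

/-- The kernel of evaluation at a point of a field is prime, so it contains the radical of `I` as
soon as it contains `I`. -/
theorem zeroLocus_sup_eq {L : Type*} [Field L] [Algebra K L]
    {I J : Ideal (MvPolynomial (Fin n) K)} (h : J ≤ I.radical) :
    zeroLocus L (J ⊔ I) = zeroLocus L I := by
  refine le_antisymm (zeroLocus_anti_mono le_sup_right) fun a ha => ?_
  have hI : I ≤ RingHom.ker (aeval (R := K) a) := fun p hp => ha p hp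
  have hJ : J ≤ RingHom.ker (aeval (R := K) a) :=
    h.trans ((RingHom.ker_isPrime _).isRadical.radical_le_iff.2 hI)
  exact fun p hp => sup_le hJ hI hp

/-- An ideal containing a separable equation for each variable has as many zeros as the dimension of
its quotient ring. -/
theorem ncard_zeroLocus_eq_finrank {K : Type u} [Field K] [CharZero K] (L : Type*) [Field L]
    [Algebra K L] [IsAlgClosed L] {n : ℕ} {g : Fin n → Polynomial K} (hg : ∀ i, (g i).Separable)
    {I : Ideal (MvPolynomial (Fin n) K)} (hI : ∀ i, Polynomial.aeval (X i) (g i) ∈ I) :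
    Module.Finite K (MvPolynomial (Fin n) K ⧸ I) ∧ (zeroLocus L I).Finite ∧
      Module.finrank K (MvPolynomial (Fin n) K ⧸ I) = (zeroLocus L I).ncard := by
  have hunr := formallyUnramified_quotient g hg hI
  have hred : IsReduced (MvPolynomial (Fin n) K ⧸ I) :=
    Algebra.FormallyUnramified.isReduced_of_field K _
  have hfin : Module.Finite K (MvPolynomial (Fin n) K ⧸ I) :=
    Algebra.FormallyUnramified.finite_of_free K _
  obtain ⟨_, hcard⟩ := card_algHom_eq_finrank K L (MvPolynomial (Fin n) K ⧸ I)
  have hzfin : Finite (zeroLocus L I) := Finite.of_equiv _ (zeroLocusEquiv L I).symm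
  refine ⟨hfin, Set.toFinite _, ?_⟩
  rw [← Nat.card_coe_set_eq, Nat.card_congr (zeroLocusEquiv L I), hcard]

end Points

/-! ### The common kernel on local cohomology -/

section CommonKernel

open MvPolynomial

variable {K : Type u} [Field K] {n s : ℕ}

/-- The tower of quotients starts with `R / (0)` rather than `R`; this shows that the change of base
module leaves the Čech differential untouched. -/
theorem modCechDiff_comp_equiv {R : Type*} [CommRing R] {s : ℕ} (f : Fin s → R)
    {M M' : Type*} [AddCommGroup M] [Module R M] [AddCommGroup M'] [Module R M']
    {A : Finset (Fin s) → Type*} [∀ S, AddCommGroup (A S)] [∀ S, Module R (A S)]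
    (ι : ∀ S, M →ₗ[R] A S) [hι : ∀ S, IsLocalizedModule (prodPowers f S) (ι S)]
    (e : M' ≃ₗ[R] M) : modCechDiff f (fun S => ι S ∘ₗ e.toLinearMap) = modCechDiff f ι := by
  funext p
  refine LinearMap.ext fun c => funext fun T => ?_
  rw [modCechDiff_apply, modCechDiff_apply, totalDiff_apply, totalDiff_apply]
  refine Finset.sum_congr rfl fun i _ => ?_
  rw [locRes_unique f (fun S => ι S ∘ₗ e.toLinearMap) (T.1.erase_subset i.1)
    (locRes f ι (T.1.erase_subset i.1)) (fun m => by simp)]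

/-- Let `G_0, …, G_{n-1}` be a regular sequence in the radical of `(f_1, …, f_s)`, generating `J`.
Their common kernel on the `n`-th Čech cohomology of `R` consists of the sections of `R / J`
supported on the zero set of the `f_i`. -/
theorem exists_torsionSections_to_modCech {R : Type u} [CommRing R] {s : ℕ} (f : Fin s → R)
    {A : Finset (Fin s) → Type u} [∀ S, AddCommGroup (A S)] [∀ S, Module R (A S)]
    (ι : ∀ S, R →ₗ[R] A S) [∀ S, IsLocalizedModule (prodPowers f S) (ι S)] (n : ℕ) (G : ℕ → R)
    (hGf : ∀ k < n, G k ∈ (Ideal.span (Set.range f)).radical)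
    (hreg : ∀ k < n, ∀ u, G k * u ∈ Ideal.span (G '' Set.Iio k) →
      u ∈ Ideal.span (G '' Set.Iio k)) :
    ∃ Δ : torsionSections f (R ⧸ Ideal.span (G '' Set.Iio n)) →ₗ[R] ModCech f ι n,
      Function.Injective Δ ∧ ∀ z, z ∈ LinearMap.range Δ ↔ ∀ k < n, G k • z = 0 := by
  let J : ℕ → Ideal R := fun k => Ideal.span (G '' Set.Iio k)
  have hJsucc : ∀ k, J (k + 1) = J k ⊔ Ideal.span {G k} := by
    intro k
    have : Set.Iio (k + 1) = Set.Iio k ∪ {k} := by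
      ext j
      simp only [Set.mem_Iio, Set.mem_union, Set.mem_singleton_iff]
      omega
    simp only [J]
    rw [this, Set.image_union, Set.image_singleton, Ideal.span_union]
  have hJmono : ∀ k, J k ≤ J (k + 1) := fun k => by
    rw [hJsucc]
    exact le_sup_left
  have hJ0 : J 0 = ⊥ := by simp [J]
  let e₀ : (R ⧸ J 0) ≃ₗ[R] R := Submodule.quotEquivOfEqBot (J 0) hJ0
  have hsmul : ∀ k (r m : R), r • Ideal.Quotient.mk (J k) m = Ideal.Quotient.mk (J k) (r * m) :=
    fun _ _ _ => rfl
  have key := modCech_of_regular f n G hGf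
    (fun k => R ⧸ J k) (fun k => Submodule.factor (hJmono k))
    (fun k _ => Submodule.factor_surjective (hJmono k))
    (fun k hk m hm => by
      obtain ⟨m, rfl⟩ := Ideal.Quotient.mk_surjective m
      rw [hsmul, Ideal.Quotient.eq_zero_iff_mem] at hm
      exact Ideal.Quotient.eq_zero_iff_mem.2 (hreg k hk m hm))
    (fun k hk m => by
      obtain ⟨m, rfl⟩ := Ideal.Quotient.mk_surjective m
      have h1 : (Submodule.factor (hJmono k)) (Ideal.Quotient.mk (J k) m) =
        Ideal.Quotient.mk (J (k + 1)) m := rfl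
      rw [h1, Ideal.Quotient.eq_zero_iff_mem, hJsucc k, Submodule.mem_sup]
      constructor
      · rintro ⟨a, ha, b, hb, rfl⟩
        obtain ⟨c, rfl⟩ := Ideal.mem_span_singleton'.1 hb
        refine ⟨Ideal.Quotient.mk (J k) c, ?_⟩
        rw [hsmul, map_add, Ideal.Quotient.eq_zero_iff_mem.2 ha, zero_add, mul_comm]
      · rintro ⟨c, hc⟩
        obtain ⟨c, rfl⟩ := Ideal.Quotient.mk_surjective c
        rw [hsmul] at hc
        exact ⟨m - G k * c, Ideal.Quotient.eq.1 hc.symm, G k * c,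
          Ideal.mul_mem_right _ _ (Ideal.mem_span_singleton_self _), by ring⟩)
    (fun S => ι S ∘ₗ e₀.toLinearMap)
  -- The cohomology type depends on the differential, so the equality of differentials is
  -- substituted with both as variables.
  have transfer : ∀ d d' : ∀ p, (∀ S : Subsets s p, A S.1) →ₗ[R] (∀ S : Subsets s (p + 1), A S.1),
      d = d' →
      (∃ Δ : torsionSections f (R ⧸ J n) →ₗ[R]
          ModCohomology (C := fun p => ∀ S : Subsets s p, A S.1) d n,
        Function.Injective Δ ∧ ∀ z, z ∈ LinearMap.range Δ ↔ ∀ k < n, G k • z = 0) →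
      ∃ Δ : torsionSections f (R ⧸ J n) →ₗ[R]
          ModCohomology (C := fun p => ∀ S : Subsets s p, A S.1) d' n,
        Function.Injective Δ ∧ ∀ z, z ∈ LinearMap.range Δ ↔ ∀ k < n, G k • z = 0 := by
    rintro d _ rfl h
    exact h
  exact transfer _ _ (modCechDiff_comp_equiv f ι e₀) key.2

/-- The common kernel of the `g_i(X_i)` on the local cohomology `H^n_I(R)`. -/
theorem commonKer_lcMul_equiv (f : Fin s → MvPolynomial (Fin n) K) (g : Fin n → Polynomial K)
    (hmonic : ∀ i, (g i).Monic) (hsep : ∀ i, (g i).Separable)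
    (hgf : ∀ i, Polynomial.aeval (X i) (g i) ∈ (Ideal.span (Set.range f)).radical) :
    ∃ J : Ideal (MvPolynomial (Fin n) K), J ≤ (Ideal.span (Set.range f)).radical ∧
      (∀ i, Polynomial.aeval (X i) (g i) ∈ J) ∧
      Nonempty (commonKer (fun i => lcMul K f n (X i)) g Finset.univ ≃ₗ[K]
        MvPolynomial (Fin n) K ⧸ (J ⊔ Ideal.span (Set.range f))) := by
  let G : Fin n → MvPolynomial (Fin n) K := fun i => Polynomial.aeval (X i) (g i)
  -- The tower is indexed by `ℕ`; only the values below `n` matter, and the value `0` beyond is a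
  -- filler.
  let Gext : ℕ → MvPolynomial (Fin n) K := fun k => if h : k < n then G ⟨k, h⟩ else 0
  have hGext : ∀ i : Fin n, Gext i.1 = G i := fun i => dif_pos i.2
  have himage : ∀ k ≤ n, Gext '' Set.Iio k = G '' {j | j.1 < k} := by
    intro k hk
    ext y
    constructor
    · rintro ⟨j, hj, rfl⟩
      exact ⟨⟨j, hj.trans_le hk⟩, hj, (hGext ⟨j, hj.trans_le hk⟩).symm⟩
    · rintro ⟨j, hj, rfl⟩
      exact ⟨j.1, hj, hGext j⟩
  have hGf : ∀ k < n, Gext k ∈ (Ideal.span (Set.range f)).radical := fun k hk => by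
    rw [hGext ⟨k, hk⟩]
    exact hgf _
  obtain ⟨J, hJ, Δ, hΔ, hΔr⟩ : ∃ J, J = Ideal.span (Gext '' Set.Iio n) ∧
      ∃ Δ : torsionSections f (MvPolynomial (Fin n) K ⧸ J) →ₗ[MvPolynomial (Fin n) K]
        ModCech f (cechMap f) n,
        Function.Injective Δ ∧ ∀ z, z ∈ LinearMap.range Δ ↔ ∀ k < n, Gext k • z = 0 :=
    ⟨_, rfl, exists_torsionSections_to_modCech f (cechMap f) n Gext hGf fun k hk u hu => by
      rw [himage k hk.le] at hu ⊢
      rw [hGext ⟨k, hk⟩] at hu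
      exact mem_span_of_aeval_mul_mem g (hmonic _) (by simp) hu⟩
  have hJn : ∀ i, G i ∈ J := fun i => hJ ▸ Ideal.subset_span ⟨i.1, i.2, hGext i⟩
  refine ⟨J, ?_, hJn, ?_⟩
  · rw [hJ, Ideal.span_le]
    rintro _ ⟨k, hk, rfl⟩
    exact hGf k hk
  have hunr := formallyUnramified_quotient g hsep hJn
  have hred : IsReduced (MvPolynomial (Fin n) K ⧸ J) :=
    Algebra.FormallyUnramified.isReduced_of_field K _
  have hfin : Module.Finite K (MvPolynomial (Fin n) K ⧸ J) :=
    Algebra.FormallyUnramified.finite_of_free K _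
  have hart : IsArtinianRing (MvPolynomial (Fin n) K ⧸ J) := isArtinian_of_tower K inferInstance
  obtain ⟨e⟩ := torsionSections_equiv K f J
  let Ψ : torsionSections f (MvPolynomial (Fin n) K ⧸ J) →ₗ[K] LocalCohomology K f n :=
    (lcEquiv K f n).symm.toLinearMap ∘ₗ Δ.restrictScalars K
  have hΨ : Function.Injective Ψ := (lcEquiv K f n).symm.injective.comp hΔ
  have hrange : LinearMap.range Ψ = commonKer (fun i => lcMul K f n (X i)) g Finset.univ := by
    ext z
    have h1 : z ∈ LinearMap.range Ψ ↔ lcEquiv K f n z ∈ LinearMap.range Δ := by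
      constructor
      · rintro ⟨y, rfl⟩
        exact ⟨y, ((lcEquiv K f n).apply_symm_apply (Δ y)).symm⟩
      · rintro ⟨y, hy⟩
        exact ⟨y, (lcEquiv K f n).symm_apply_eq.2 hy⟩
    have h2 : ∀ i : Fin n, Polynomial.aeval (lcMul K f n (X i)) (g i) = lcMul K f n (G i) :=
      fun i => Polynomial.aeval_algHom_apply _ _ _
    rw [h1, mem_commonKer, hΔr]
    constructor
    · intro h i _
      rw [h2]
      apply (lcEquiv K f n).injective
      rw [lcEquiv_lcMul, map_zero, ← hGext i]
      exact h i.1 i.2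
    · intro h k hk
      have h3 := h ⟨k, hk⟩ (Finset.mem_univ _)
      rw [h2] at h3
      rw [hGext ⟨k, hk⟩, ← lcEquiv_lcMul, h3, map_zero]
  exact ⟨(LinearEquiv.ofEq _ _ hrange.symm).trans
    ((LinearEquiv.ofInjective Ψ hΨ).symm.trans e)⟩

end CommonKernel

/-! ### Weyl algebra relations on local cohomology -/

section Partial

open MvPolynomial

variable {K : Type u} [Field K] {n s : ℕ} (f : Fin s → MvPolynomial (Fin n) K) (p : ℕ)

/-- The commutator is a derivation vanishing on the variables. -/
theorem pderiv_pderiv_comm (i j : Fin n) (r : MvPolynomial (Fin n) K) :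
    pderiv i (pderiv j r) = pderiv j (pderiv i r) := by
  have h : ⁅pderiv (R := K) i, pderiv (R := K) j⁆ = 0 := by
    refine MvPolynomial.derivation_ext fun k => ?_
    rw [Derivation.commutator_apply, pderiv_X, pderiv_X]
    simp only [Pi.single_apply]
    split_ifs <;> simp
  have h1 := Derivation.congr_fun h r
  rw [Derivation.commutator_apply] at h1
  exact sub_eq_zero.1 h1

theorem lcPartial_comm (i j : Fin n) :
    (lcPartial f p i : Module.End K _) * lcPartial f p j = lcPartial f p j * lcPartial f p i :=
  LinearMap.ext fun z => lcDerivation_comm f (pderiv_pderiv_comm i j) p z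

theorem lcPartial_lcMul_X_of_ne {i j : Fin n} (h : i ≠ j) :
    (lcPartial f p i : Module.End K _) * lcMul K f p (X j) =
      lcMul K f p (X j) * lcPartial f p i := by
  refine LinearMap.ext fun z => ?_
  have h1 := lcDerivation_lcMul f (pderiv i) p (X j) z
  rw [pderiv_X_of_ne h.symm, map_zero, LinearMap.zero_apply, add_zero] at h1
  exact h1

theorem lcPartial_lcMul_X (i : Fin n) :
    (lcPartial f p i : Module.End K _) * lcMul K f p (X i) -
      lcMul K f p (X i) * lcPartial f p i = 1 := by
  refine LinearMap.ext fun z => ?_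
  have h1 := lcDerivation_lcMul f (pderiv i) p (X i) z
  rw [pderiv_X_self, map_one] at h1
  exact sub_eq_iff_eq_add'.2 h1

theorem lcMul_X_torsion (i : Fin n) {g : Polynomial K}
    (hg : Polynomial.aeval (X i) g ∈ (Ideal.span (Set.range f)).radical)
    (z : LocalCohomology K f p) : ∃ k, Polynomial.aeval (lcMul K f p (X i)) (g ^ k) z = 0 := by
  obtain ⟨k, hk⟩ := modCech_radical_torsion f (cechMap f) hg (lcEquiv K f p z)
  refine ⟨k, ?_⟩
  rw [Polynomial.aeval_algHom_apply, map_pow]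
  apply (lcEquiv K f p).injective
  rw [lcEquiv_lcMul, hk, map_zero]

end Partial

end DeRhamLC

/-! ### De Rham cohomology and the number of points -/

open DeRhamLC MvPolynomial in
theorem theorem1 {K : Type u} [Field K] [CharZero K] {L : Type v} [Field L] [Algebra K L]
    [IsAlgClosed L] {n : ℕ} (I : Ideal (MvPolynomial (Fin n) K))
    (hI : DeRhamLC.IsZeroDimensional I)
    {s : ℕ} (f : Fin s → MvPolynomial (Fin n) K) (hf : Ideal.span (Set.range f) = I) :
    (∀ i < n, Subsingleton (DeRhamLC.DeRhamCohomology (DeRhamLC.lcPartial f n) i)) ∧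
    (MvPolynomial.zeroLocus L I).Finite ∧
    Module.Finite K (DeRhamLC.DeRhamCohomology (DeRhamLC.lcPartial f n) n) ∧
    Module.finrank K (DeRhamLC.DeRhamCohomology (DeRhamLC.lcPartial f n) n) =
      (MvPolynomial.zeroLocus L I).ncard := by
  choose g hmonic hsep hgI using exists_separable_aeval_mem_radical hI
  subst hf
  obtain ⟨J, hJI, hJ, ⟨e⟩⟩ := commonKer_lcMul_equiv f g hmonic hsep hgI
  have hdd := lcPartial_comm f n
  have hxx : ∀ i j : Fin n, lcMul K f n (X i) * lcMul K f n (X j) =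
      lcMul K f n (X j) * lcMul K f n (X i) := fun i j => by
    rw [← map_mul, ← map_mul, mul_comm]
  have hdx := fun (i j : Fin n) (h : i ≠ j) => lcPartial_lcMul_X_of_ne f n h
  have h1 := lcPartial_lcMul_X f n
  have htors := fun i => lcMul_X_torsion f n i (hgI i)
  obtain ⟨e'⟩ := deRhamCohomology_top_equiv hdd hxx hdx h1 hsep htors
  -- The count is applied to `J ⊔ I`, not `I`: the separable equations are only known to lie in the
  -- radical of `I`, but `J` contains them and adding `J` does not change the zero locus.
  obtain ⟨hfin, hzfin, hcard⟩ := ncard_zeroLocus_eq_finrank L hsep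
    (fun i => (le_sup_left : J ≤ J ⊔ Ideal.span (Set.range f)) (hJ i))
  rw [zeroLocus_sup_eq hJI] at hzfin hcard
  have hvan : ∀ p < n, Subsingleton (DeRhamCohomology (lcPartial f n) p) := fun p hp =>
    deRhamCohomology_subsingleton hdd hxx hdx h1 hsep htors hp
  exact ⟨hvan, hzfin, Module.Finite.equiv (e.symm.trans e'),
    (e.symm.trans e').finrank_eq.symm.trans hcard⟩

end
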